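/- Let $M$ be a (Hausdorff) smooth $n$-dimensional manifold with a smooth pseudo-Riemannian metric $g$ of arbitrary signature (for instance a space-time, where $g$ is Lorentzian), and let $\nabla$ be its Levi-Civita connection, with curvature tensor $R(Y,Z)X=\nabla_Y\nabla_Z X-\nabla_Z\nabla_Y X-\nabla_{[Y,Z]}X$. Vector fields and functions are smooth and may be defined only on open subsets of $M$. A $p$-distribution is a smooth rank-$p$ subbundle of $TM$; a $q$-foliation is a $q$-distribution that has a $q$-dimensional integral submanifold through every point. Let $\Omega$ be a $p$-distribution and $\Omega'$ a $q$-foliation on $M$. Say that - $\Omega$ is stable with respect to $\Omega'$, written $\nabla_{\Omega'}\Omega\subset\Omega$, if $\nabla_Y X\in\Omega$ for all vector fields $X\in\Omega$ and $Y\in\Omega'$; - $\Omega$ is regularly stable with respect to $\Omega'$, written $\nabla_{\Omega'}\Omega=0$, if around every point of $M$ there is a local basis $\{X_i\}_{i=1}^{p}$ of $\Omega$ such that $\nabla_Y X_i=0$ for $i=1,\dots,p$ and every vector field $Y\in\Omega'$. Then: (i) if $(M,g)$ is flat, i.e. $R=0$ (for instance Minkowski space-time), then $\nabla_{\Omega'}\Omega\subset\Omega$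 if and only if $\nabla_{\Omega'}\Omega=0$; (ii) if $q=1$, then $\nabla_{\Omega'}\Omega\subset\Omega$ if and only if $\nabla_{\Omega'}\Omega=0$. -/

import Mathlib

open Bundle
open scoped Manifold ContDiff Topology

noncomputable section

namespace Foliation

variable {n : ℕ} {M : Type*} [TopologicalSpace M] [ChartedSpace (EuclideanSpace ℝ (Fin n)) M]

/-- A (not necessarily continuous) vector field on the `n`-dimensional manifold `M`. -/
abbrev Field (n : ℕ) (M : Type*) [TopologicalSpace M]
    [ChartedSpace (EuclideanSpace ℝ (Fin n)) M] : Type _ :=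
  (x : M) → TangentSpace (𝓡 n) x

variable [IsManifold (𝓡 n) ∞ M]

/-- The vector field `X` is smooth on `U`. A smooth vector field defined on an open set `U` is
represented by any extension of it to `M`; the values outside `U` are irrelevant. -/
def SmoothFieldOn (X : Field n M) (U : Set M) : Prop :=
  ContMDiffOn (𝓡 n) (𝓡 n).tangent ∞
    (fun x => (⟨x, X x⟩ : TangentBundle (𝓡 n) M)) U

/-! ### Pseudo-Riemannian metrics and their Levi-Civita connection -/

/-- A smooth pseudo-Riemannian metric, of arbitrary signature, on `M`: a smooth field of symmetric
nondegenerate bilinear forms on the tangent spaces. The Lorentzian metrics of space-times are the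
ones of signature `(1, n - 1)`. -/
structure PseudoRiemannianMetric (n : ℕ) (M : Type*) [TopologicalSpace M]
    [ChartedSpace (EuclideanSpace ℝ (Fin n)) M] [IsManifold (𝓡 n) ∞ M] where
  /-- The bilinear form on each tangent space. -/
  val (x : M) : TangentSpace (𝓡 n) x →L[ℝ] TangentSpace (𝓡 n) x →L[ℝ] ℝ
  symm (x : M) (v w : TangentSpace (𝓡 n) x) : val x v w = val x w v
  nondegenerate (x : M) (v : TangentSpace (𝓡 n) x) (hv : ∀ w, val x v w = 0) : v = 0
  smooth : ContMDiff (𝓡 n)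
    ((𝓡 n).prod 𝓘(ℝ, EuclideanSpace ℝ (Fin n) →L[ℝ] EuclideanSpace ℝ (Fin n) →L[ℝ] ℝ)) ∞
    (fun x => TotalSpace.mk' (EuclideanSpace ℝ (Fin n) →L[ℝ] EuclideanSpace ℝ (Fin n) →L[ℝ] ℝ)
      (E := fun x : M => TangentSpace (𝓡 n) x →L[ℝ] TangentSpace (𝓡 n) x →L[ℝ] ℝ) x (val x))

/-- An affine connection on `M`. On paper `nabla X x v` is `∇_v X`, for `v` tangent at `x`. -/
abbrev Connection (n : ℕ) (M : Type*) [TopologicalSpace M]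
    [ChartedSpace (EuclideanSpace ℝ (Fin n)) M] [IsManifold (𝓡 n) ∞ M] : Type _ :=
  CovariantDerivative (𝓡 n) (EuclideanSpace ℝ (Fin n)) (fun x : M => TangentSpace (𝓡 n) x)

/-- `nabla` is the Levi-Civita connection of `g`: the smooth connection that is torsion-free and
satisfies `v (g(X, Z)) = g(∇_v X, Z) + g(X, ∇_v Z)`. -/
structure IsLeviCivita (g : PseudoRiemannianMetric n M) (nabla : Connection n M) : Prop where
  smooth : CovariantDerivative.ContMDiffCovariantDerivative nabla ∞
  torsion_free : nabla.torsion = 0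
  metric (U : Set M) (hU : IsOpen U) (X Z : Field n M)
    (hX : SmoothFieldOn X U) (hZ : SmoothFieldOn Z U) (x : M) (hx : x ∈ U)
    (v : TangentSpace (𝓡 n) x) :
    mvfderiv (𝓡 n) (fun y => g.val y (X y) (Z y)) x v =
      g.val x (nabla X x v) (Z x) + g.val x (X x) (nabla Z x v)

/-- The vector field `∇_Y X`. -/
def covDeriv (nabla : Connection n M) (Y X : Field n M) : Field n M :=
  fun x => nabla X x (Y x)

/-- The Riemann curvature
`R(Y, Z) X = ∇_Y ∇_Z X - ∇_Z ∇_Y X - ∇_{[Y, Z]} X`. -/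
def curvature (nabla : Connection n M) (Y Z X : Field n M) : Field n M :=
  covDeriv nabla Y (covDeriv nabla Z X) - covDeriv nabla Z (covDeriv nabla Y X)
    - covDeriv nabla (VectorField.mlieBracket (𝓡 n) Y Z) X

/-- The curvature tensor vanishes identically. -/
def IsFlat (nabla : Connection n M) : Prop :=
  ∀ U : Set M, IsOpen U → ∀ X Y Z : Field n M,
    SmoothFieldOn X U → SmoothFieldOn Y U → SmoothFieldOn Z U →
      ∀ x ∈ U, curvature nabla Y Z X x = 0

/-! ### Distributions and foliations -/

/-- A field of tangent subspaces. -/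
abbrev SubspaceField (n : ℕ) (M : Type*) [TopologicalSpace M]
    [ChartedSpace (EuclideanSpace ℝ (Fin n)) M] : Type _ :=
  (x : M) → Submodule ℝ (TangentSpace (𝓡 n) x)

/-- `X` is a smooth vector field of `D` on the open set `U`. -/
structure IsFieldOf (D : SubspaceField n M) (U : Set M) (X : Field n M) : Prop where
  isOpen : IsOpen U
  smooth : SmoothFieldOn X U
  mem (x : M) (hx : x ∈ U) : X x ∈ D x

/-- The vector fields `X 1, …, X p` form a basis of `D` on the open set `U`. -/
structure IsLocalBasis (D : SubspaceField n M) (U : Set M) {p : ℕ} (X : Fin p → Field n M) :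
    Prop where
  isOpen : IsOpen U
  smooth (i : Fin p) : SmoothFieldOn (X i) U
  linearIndependent (x : M) (hx : x ∈ U) : LinearIndependent ℝ (fun i => X i x)
  span (x : M) (hx : x ∈ U) : Submodule.span ℝ (Set.range fun i => X i x) = D x

/-- `D` is a `p`-distribution: a smooth subbundle of rank `p` of the tangent bundle. -/
def IsDistribution (p : ℕ) (D : SubspaceField n M) : Prop :=
  ∀ x : M, ∃ U : Set M, x ∈ U ∧ ∃ X : Fin p → Field n M, IsLocalBasis D U X

/-- There is a `q`-dimensional integral submanifold of `D` through `x`: it is given by an immersion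
of a neighbourhood of `0` in `ℝ^q` that sends `0` to `x` and whose tangent spaces are those
of `D`. -/
def HasLeafAt (q : ℕ) (D : SubspaceField n M) (x : M) : Prop :=
  ∃ (W : Set (EuclideanSpace ℝ (Fin q))) (φ : EuclideanSpace ℝ (Fin q) → M),
    IsOpen W ∧ 0 ∈ W ∧ φ 0 = x ∧ ContMDiffOn (𝓡 q) (𝓡 n) ∞ φ W ∧
      ∀ u ∈ W, Function.Injective (mfderiv (𝓡 q) (𝓡 n) φ u) ∧
        (mfderiv (𝓡 q) (𝓡 n) φ u).toLinearMap.range = D (φ u)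

/-- `D` is a `q`-foliation: a `q`-distribution with an integral submanifold through every point. -/
def IsFoliation (q : ℕ) (D : SubspaceField n M) : Prop :=
  IsDistribution q D ∧ ∀ x : M, HasLeafAt q D x

/-! ### Stability -/

/-- `D` is stable with respect to `D'`, in symbols `∇_{D'} D ⊂ D`: one has `∇_Y X ∈ D` for all
vector fields `X ∈ D` and `Y ∈ D'`. -/
def IsStable (nabla : Connection n M) (D D' : SubspaceField n M) : Prop :=
  ∀ (U : Set M) (X Y : Field n M), IsFieldOf D U X → IsFieldOf D' U Y →
    ∀ x ∈ U, covDeriv nabla Y X x ∈ D x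

/-- The `p`-distribution `D` is regularly stable with respect to `D'`, in symbols `∇_{D'} D = 0`:
around every point there is a local basis `X 1, …, X p` of `D` such that `∇_Y (X i) = 0` for all
`i` and all vector fields `Y ∈ D'`. -/
def IsRegularlyStable (nabla : Connection n M) (p : ℕ) (D D' : SubspaceField n M) : Prop :=
  ∀ x : M, ∃ U : Set M, x ∈ U ∧ ∃ X : Fin p → Field n M, IsLocalBasis D U X ∧
    ∀ (i : Fin p) (V : Set M) (Y : Field n M), IsFieldOf D' V Y →
      ∀ y ∈ U ∩ V, covDeriv nabla Y (X i) y = 0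

end Foliation

end

-- Regular stability implies stability by the Leibniz rule: if `X = ∑ f_i X_i` with `∇_Y X_i = 0`,
-- then `∇_Y X = ∑ Y(f_i) X_i` lies in `Ω`.
--
-- For the converse, write `∇_v X = dX(v) + Γ(v) X` in a chart. Call a gauge an operator-valued
-- function `B` near the base point, the identity there, with `dB(v) = -Γ(v) B` for `v ∈ Ω'`. If a
-- frame of `Ω` is written `w = B C`, then `∇_v w = B dC(v)`: in the gauge, covariant derivatives
-- along `Ω'` are plain derivatives, and stability says that `dC(v)` takes values in the range of
-- `C`. Choose a fixed left inverse `P` of `w` at the base point and normalise to `C' = C (P C)⁻¹`,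
-- so that `P C' = id`. Then `P dC'(v) = 0`, whereas stability gives `dC'(v) a = C' b`; hence `b = P
-- C' b = 0` and `dC'(v) = 0`. The frame `B C'` spans `Ω` and is parallel along `Ω'`
-- (`exists_parallel_frame_of_stable`). No equation has to be integrated apart from the one for `B`.
--
-- A gauge exists in both cases. If the curvature vanishes, parallel transport along rays from the
-- base point is parallel in every direction (`exists_parallel_of_flat`). If `q = 1`, a flow box for
-- a generator of `Ω'` reduces the equation to a linear ODE along the flow lines
-- (`exists_transport_along_field`). Both rest on smooth dependence of ODE solutions on time and
-- initial data (`exists_smooth_flow`), which comes from the implicit function theorem in the Banach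
-- space of curves.

universe u

/-! ### Composition operators on spaces of continuous functions. -/

section Nemytskii

variable {K : Type*} [TopologicalSpace K] [CompactSpace K]
variable {E F G : Type u} [NormedAddCommGroup E] [NormedSpace ℝ E]
  [NormedAddCommGroup F] [NormedSpace ℝ F] [NormedAddCommGroup G] [NormedSpace ℝ G]

/-- The pointwise application of a bilinear map to two continuous functions. -/
noncomputable def ContinuousMap.pointwiseBilin (K : Type*) [TopologicalSpace K] [CompactSpace K]
    (B : G →L[ℝ] E →L[ℝ] F) : C(K, G) →L[ℝ] C(K, E) →L[ℝ] C(K, F) :=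
  LinearMap.mkContinuous₂
    (LinearMap.mk₂ ℝ (fun (A : C(K, G)) (γ : C(K, E)) =>
        (⟨fun t => B (A t) (γ t), by fun_prop⟩ : C(K, F)))
      (fun A A' γ => by ext; simp) (fun c A γ => by ext; simp)
      (fun A γ γ' => by ext; simp) (fun c A γ => by ext; simp)) ‖B‖
    (fun A γ => by
      rw [ContinuousMap.norm_le _ (by positivity)]
      intro t
      simp only [LinearMap.mk₂_apply, ContinuousMap.coe_mk]
      exact (B.le_opNorm₂ _ _).trans (by
        gcongr
        · exact A.norm_coe_le_norm t
        · exact γ.norm_coe_le_norm t))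

/-- If `f` has derivative `B (D y)` at every `y`, with `D` continuous, then composition with `f` is
differentiable on the space of continuous functions on a compact space. -/
theorem hasFDerivAt_continuousMap_comp (f : C(E, F)) (B : G →L[ℝ] E →L[ℝ] F) (D : C(E, G))
    (hf : ∀ y, HasFDerivAt f (B (D y)) y) (γ : C(K, E)) :
    HasFDerivAt (fun γ : C(K, E) => f.comp γ)
      (ContinuousMap.pointwiseBilin K B (D.comp γ)) γ := by
  rw [hasFDerivAt_iff_isLittleO_nhds_zero, Asymptotics.isLittleO_iff]
  intro ε hε
  -- Continuity of `γ ↦ D ∘ γ` for the sup norm gives a bound uniform over `K`; `E` need not be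
  -- locally compact.
  have hcont : ContinuousAt (fun γ : C(K, E) => D.comp γ) γ :=
    (ContinuousMap.continuous_postcomp D).continuousAt
  have hε' : 0 < ε / (‖B‖ + 1) := by positivity
  obtain ⟨δ, hδ, hball⟩ := Metric.continuousAt_iff.1 hcont _ hε'
  filter_upwards [Metric.ball_mem_nhds (0 : C(K, E)) hδ] with h hh
  rw [mem_ball_zero_iff] at hh
  rw [ContinuousMap.norm_le _ (by positivity)]
  intro t
  have key : ∀ y ∈ segment ℝ (γ t) (γ t + h t), ‖B (D y) - B (D (γ t))‖ ≤ ε := by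
    intro y hy
    rw [segment_eq_image'] at hy
    obtain ⟨s, hs, rfl⟩ := hy
    have h1 : dist (γ + s • h) γ < δ := by
      rw [dist_eq_norm, add_sub_cancel_left, norm_smul, Real.norm_of_nonneg hs.1]
      calc s * ‖h‖ ≤ 1 * ‖h‖ := by gcongr; exact hs.2
        _ < δ := by simpa using hh
    have h2 := (hball h1).le
    have h3 := (ContinuousMap.norm_coe_le_norm (D.comp (γ + s • h) - D.comp γ) t)
    rw [← dist_eq_norm] at h3
    have h4 : ‖D (γ t + s • h t) - D (γ t)‖ ≤ ε / (‖B‖ + 1) := by simpa using h3.trans h2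
    simp only [add_sub_cancel_left]
    rw [← map_sub]
    calc ‖B (D (γ t + s • h t) - D (γ t))‖ ≤ ‖B‖ * (ε / (‖B‖ + 1)) := B.le_opNorm_of_le h4
      _ ≤ (‖B‖ + 1) * (ε / (‖B‖ + 1)) := by gcongr; linarith
      _ = ε := by field_simp
  have := (convex_segment (γ t) (γ t + h t)).norm_image_sub_le_of_norm_hasFDerivWithin_le'
    (fun y _ => (hf y).hasFDerivWithinAt) key (left_mem_segment ℝ _ _)
    (right_mem_segment ℝ _ _)
  simp only [add_sub_cancel_left] at this
  have h5 : ε * ‖h t‖ ≤ ε * ‖h‖ := by gcongr; exact h.norm_coe_le_norm t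
  exact this.trans h5

/-- Induction on the order of differentiability: the derivative of composition with `f` is the
pointwise action of composition with `f'`, and `f'` is again smooth. The target is generalised
because it becomes `E →L[ℝ] F` at each step. -/
theorem ContDiff.continuousMap_comp {f : E → F} (hf : ContDiff ℝ ∞ f) :
    ContDiff ℝ ∞ (fun γ : C(K, E) => (⟨f, hf.continuous⟩ : C(E, F)).comp γ) := by
  rw [contDiff_infty]
  intro k
  induction k generalizing F with
  | zero => exact contDiff_zero.2 (ContinuousMap.continuous_postcomp _)
  | succ k ih =>
    have hf' : ContDiff ℝ ∞ (fderiv ℝ f) := hf.fderiv_right (by simp)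
    have ih' := ih hf'
    push_cast
    rw [contDiff_succ_iff_hasFDerivAt]
    refine ⟨_, (ContinuousMap.pointwiseBilin K (ContinuousLinearMap.id ℝ (E →L[ℝ] F))).contDiff.comp
      ih', fun γ => ?_⟩
    exact hasFDerivAt_continuousMap_comp ⟨f, hf.continuous⟩ (ContinuousLinearMap.id ℝ (E →L[ℝ] F))
      ⟨fderiv ℝ f, hf'.continuous⟩ (fun y => (hf.differentiable (by simp) y).hasFDerivAt) γ

end Nemytskii

/-! ### Primitives on the unit interval, and smooth implicit functions. -/

section Primitive

variable {E : Type*} [NormedAddCommGroup E] [NormedSpace ℝ E]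

/-- The primitive, vanishing at `0`, of a continuous function on the unit interval. -/
noncomputable def unitInterval.primitive (E : Type*) [NormedAddCommGroup E] [NormedSpace ℝ E] :
    C(unitInterval, E) →L[ℝ] C(unitInterval, E) :=
  LinearMap.mkContinuous
    { toFun := fun γ => ⟨fun t => ∫ s in (0 : ℝ)..t, Set.IccExtend zero_le_one γ s, by
        have : Continuous fun t : ℝ => ∫ s in (0 : ℝ)..t, Set.IccExtend zero_le_one γ s :=
          intervalIntegral.continuous_primitive
            (fun a b => (γ.continuous.Icc_extend' (h := zero_le_one)).intervalIntegrable a b) 0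
        exact this.comp continuous_subtype_val⟩
      map_add' := fun γ η => by
        ext t
        simp only [ContinuousMap.coe_mk, ContinuousMap.add_apply]
        rw [← intervalIntegral.integral_add
          ((γ.continuous.Icc_extend' (h := zero_le_one)).intervalIntegrable _ _)
          ((η.continuous.Icc_extend' (h := zero_le_one)).intervalIntegrable _ _)]
        rfl
      map_smul' := fun c γ => by
        ext t
        simp only [ContinuousMap.coe_mk, ContinuousMap.smul_apply, RingHom.id_apply]
        rw [← intervalIntegral.integral_smul]
        rfl } 1
    (fun γ => by
      rw [ContinuousMap.norm_le _ (by positivity)]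
      intro t
      have := intervalIntegral.norm_integral_le_of_norm_le_const (a := 0) (b := (t : ℝ))
        (f := Set.IccExtend zero_le_one γ) (C := ‖γ‖) (fun s _ => γ.norm_coe_le_norm _)
      simp only [LinearMap.coe_mk, AddHom.coe_mk, ContinuousMap.coe_mk, one_mul]
      refine this.trans ?_
      rw [sub_zero, abs_of_nonneg t.2.1]
      exact mul_le_of_le_one_right (norm_nonneg _) t.2.2)

end Primitive

/-- The implicit function theorem, with smoothness of the implicit function on a neighbourhood. -/
theorem exists_smooth_implicitFunction {P C F : Type*} [NormedAddCommGroup P] [NormedSpace ℝ P]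
    [CompleteSpace P] [NormedAddCommGroup C] [NormedSpace ℝ C] [CompleteSpace C]
    [NormedAddCommGroup F] [NormedSpace ℝ F] [CompleteSpace F]
    {G : P × C → F} (hG : ContDiff ℝ ∞ G) (u : P × C)
    (hu : (fderiv ℝ G u ∘L .inr ℝ P C).IsInvertible) :
    ∃ ψ : P → C, ψ u.1 = u.2 ∧ (∀ᶠ p in 𝓝 u.1, ContDiffAt ℝ ∞ ψ p) ∧
      (∀ᶠ p in 𝓝 u.1, G (p, ψ p) = G u) ∧ ∀ᶠ v in 𝓝 u, G v = G u ↔ ψ v.1 = v.2 := by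
  have hne : (∞ : ℕ∞ω) ≠ 0 := by simp
  have cdf : ContDiffAt ℝ ∞ G u := hG.contDiffAt
  set ψ := cdf.implicitFunction hne hu with hψ
  have hself : ψ u.1 = u.2 := cdf.implicitFunction_apply_self hne hu
  have hsm : ContDiffAt ℝ ∞ ψ u.1 := cdf.contDiffAt_implicitFunction hne hu
  have heq := cdf.eventually_apply_implicitFunction hne hu
  refine ⟨ψ, hself, ?_, heq, cdf.eventually_apply_eq_iff_implicitFunction hne hu⟩
  -- Being `C^∞` at one point gives a neighbourhood for each finite order, possibly shrinking with
  -- the order. So the theorem is applied afresh at each nearby `(p, ψ p)`, and local uniqueness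
  -- identifies the new implicit function with `ψ` near `p`.
  have hcont : ∀ᶠ p in 𝓝 u.1, ContinuousAt ψ p :=
    ((hsm.of_le (m := 1) (by simp)).eventually (by simp)).mono fun p hp => hp.continuousAt
  have hpair : Filter.Tendsto (fun p => (p, ψ p)) (𝓝 u.1) (𝓝 u) := by
    have : Filter.Tendsto (fun p => (p, ψ p)) (𝓝 u.1) (𝓝 (u.1, ψ u.1)) :=
      continuousAt_id.prodMk hsm.continuousAt
    rwa [hself] at this
  have hinv : ∀ᶠ v in 𝓝 u, (fderiv ℝ G v ∘L .inr ℝ P C).IsInvertible := by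
    obtain ⟨e, he⟩ := hu
    have hc : ContinuousAt (fun v => fderiv ℝ G v ∘L .inr ℝ P C) u :=
      ((hG.continuous_fderiv hne).clm_comp continuous_const).continuousAt
    have hn := e.nhds
    rw [he] at hn
    filter_upwards [hc hn] with v hv
    exact hv
  filter_upwards [hcont, hpair.eventually hinv, heq, heq.eventually_nhds] with p hp hpi hpe hpn
  have cdf' : ContDiffAt ℝ ∞ G (p, ψ p) := hG.contDiffAt
  have h1 := cdf'.eventually_apply_eq_iff_implicitFunction hne hpi
  have hpair' : Filter.Tendsto (fun p => (p, ψ p)) (𝓝 p) (𝓝 (p, ψ p)) := continuousAt_id.prodMk hp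
  refine (cdf'.contDiffAt_implicitFunction hne hpi).congr_of_eventuallyEq ?_
  filter_upwards [hpair'.eventually h1, hpn] with p' h2 h3
  exact (h2.1 (h3.trans hpe.symm)).symm

/-! ### Smooth local flows. -/

section Flow

variable {E : Type u} [NormedAddCommGroup E] [NormedSpace ℝ E]

/-- The defect, in the integral equation `γ t = x + ε ∫₀ᵗ f (γ s) ds`, of a curve on `[0, 1]`. -/
noncomputable def integralEquation {f : E → E} (hf : Continuous f)
    (v : (ℝ × E) × C(unitInterval, E)) : C(unitInterval, E) :=
  v.2 - ContinuousMap.const _ v.1.2 -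
    v.1.1 • unitInterval.primitive E ((⟨f, hf⟩ : C(E, E)).comp v.2)

theorem contDiff_integralEquation {f : E → E} (hf : ContDiff ℝ ∞ f) :
    ContDiff ℝ ∞ (integralEquation hf.continuous) := by
  have h1 : ContDiff ℝ ∞ (fun x : E => ContinuousMap.const unitInterval x) :=
    (ContinuousLinearMap.const ℝ unitInterval (M := E)).contDiff
  refine (contDiff_snd.sub (h1.comp (contDiff_snd.comp contDiff_fst))).sub ?_
  refine (contDiff_fst.comp contDiff_fst).smul ?_
  exact (unitInterval.primitive E).contDiff.comp (hf.continuousMap_comp.comp contDiff_snd)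

theorem integralEquation_eq_zero_iff {f : E → E} (hf : Continuous f) (ε : ℝ) (x : E)
    (γ : C(unitInterval, E)) :
    integralEquation hf ((ε, x), γ) = 0 ↔
      ∀ t : unitInterval, γ t = x + ε • ∫ s in (0 : ℝ)..t, f (Set.IccExtend zero_le_one γ s) := by
  rw [ContinuousMap.ext_iff]
  refine forall_congr' fun t => ?_
  simp only [integralEquation, ContinuousMap.sub_apply, ContinuousMap.zero_apply, sub_sub, sub_eq_zero]
  rfl

/-- At `ε = 0` the integral term disappears and the defect is `η - x`. This is the invertibility
needed to solve for the curve by the implicit function theorem. -/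
theorem fderiv_integralEquation_comp_inr {f : E → E} (hf : ContDiff ℝ ∞ f) (x : E)
    (γ : C(unitInterval, E)) :
    fderiv ℝ (integralEquation hf.continuous) ((0, x), γ) ∘L .inr ℝ (ℝ × E) C(unitInterval, E) =
      ContinuousLinearMap.id ℝ _ := by
  have h1 : HasFDerivAt (integralEquation hf.continuous) _ ((0, x), γ) :=
    ((contDiff_integralEquation hf).differentiable (by simp) _).hasFDerivAt
  have h2 : HasFDerivAt (fun η : C(unitInterval, E) => (((0, x), η) : (ℝ × E) × C(unitInterval, E)))
      (.inr ℝ (ℝ × E) C(unitInterval, E)) γ := hasFDerivAt_prodMk_right _ _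
  have h3 := h1.comp γ h2
  refine h3.unique ?_
  have : integralEquation hf.continuous ∘
      (fun η : C(unitInterval, E) => (((0, x), η) : (ℝ × E) × C(unitInterval, E))) =
      fun η => η - ContinuousMap.const _ x := by
    ext η t; simp [integralEquation]
  rw [this]
  exact (hasFDerivAt_id γ).sub_const _

/-- A smooth vector field on a Banach space has a smooth local flow. -/
theorem exists_smooth_flow [CompleteSpace E] {f : E → E} (hf : ContDiff ℝ ∞ f) (x₀ : E) :
    ∃ δ > 0, ∃ φ : ℝ × E → E, ∀ p ∈ Metric.ball ((0 : ℝ), x₀) δ,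
      ContDiffAt ℝ ∞ φ p ∧ φ (0, p.2) = p.2 ∧
        HasDerivAt (fun t => φ (t, p.2)) (f (φ p)) p.1 := by
  set c₀ : C(unitInterval, E) := ContinuousMap.const _ x₀ with hc₀
  have hG0 : integralEquation hf.continuous ((0, x₀), c₀) = 0 := by
    rw [integralEquation_eq_zero_iff]; simp [hc₀]
  obtain ⟨ψ, hψ0, hψs, hψe, hψu⟩ := exists_smooth_implicitFunction
    (contDiff_integralEquation hf) ((0, x₀), c₀) (by
      rw [fderiv_integralEquation_comp_inr hf]; exact ⟨.refl ℝ _, rfl⟩)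
  rw [hG0] at hψe
  simp only [hG0] at hψu
  simp only at hψ0 hψs hψe
  obtain ⟨r, hr, hru⟩ := Metric.eventually_nhds_iff_ball.1 hψu
  have hψc : ContinuousAt ψ (0, x₀) := hψs.self_of_nhds.continuousAt
  have hψr := hψc.eventually (Metric.ball_mem_nhds _ hr)
  rw [hψ0] at hψr
  obtain ⟨δ', hδ', hall⟩ := Metric.eventually_nhds_iff_ball.1 (hψs.and (hψe.and hψr))
  -- `δ'` controls `ψ` and its curves; `r` keeps the parameters in the ball where solutions are
  -- unique.
  set δ := min δ' r with hδ
  have hδpos : 0 < δ := lt_min hδ' hr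
  have hsmall : ∀ t x, (t, x) ∈ Metric.ball ((0 : ℝ), x₀) δ ↔ |t| < δ ∧ dist x x₀ < δ := by
    intro t x
    simp [Prod.dist_eq]
  -- the curve at a rescaled time is the rescaled curve
  have hscale : ∀ t x, (t, x) ∈ Metric.ball ((0 : ℝ), x₀) δ → ∀ s : unitInterval,
      ψ (t * s, x) 1 = ψ (t, x) s := by
    intro t x htx s
    have htx' := hall _ (Metric.ball_subset_ball (min_le_left _ _) htx)
    -- By substitution in the integral, the curve run at speed `s` solves the equation with
    -- parameter `t * s`. It stays near `c₀`, so uniqueness applies.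
    set η : C(unitInterval, E) := (ψ (t, x)).comp ⟨fun τ => s * τ, by fun_prop⟩ with hη
    have hηG : integralEquation hf.continuous ((t * s, x), η) = 0 := by
      rw [integralEquation_eq_zero_iff]
      intro τ
      have h1 := (integralEquation_eq_zero_iff hf.continuous t x _).1 htx'.2.1 (s * τ)
      have h2 : (s : ℝ) • ∫ σ in (0 : ℝ)..τ, f (Set.IccExtend zero_le_one η σ) =
          ∫ σ in (0 : ℝ)..(s * τ : unitInterval), f (Set.IccExtend zero_le_one (ψ (t, x)) σ) := by
        have h3 := intervalIntegral.smul_integral_comp_mul_left (a := 0) (b := (τ : ℝ))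
          (fun σ => f (Set.IccExtend zero_le_one (ψ (t, x)) σ)) (s : ℝ)
        rw [mul_zero] at h3
        refine Eq.trans ?_ h3
        congr 1
        refine intervalIntegral.integral_congr fun σ hσ => ?_
        rw [Set.uIcc_of_le τ.2.1] at hσ
        have hσ' : σ ∈ Set.Icc (0 : ℝ) 1 := ⟨hσ.1, hσ.2.trans τ.2.2⟩
        have hσs : (s : ℝ) * σ ∈ Set.Icc (0 : ℝ) 1 := (s * ⟨σ, hσ'⟩ : unitInterval).2
        rw [Set.IccExtend_of_mem _ _ hσ', Set.IccExtend_of_mem _ _ hσs]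
        rfl
      rw [mul_smul, h2]
      exact h1
    have hball : ((t * s, x), η) ∈ Metric.ball (((0 : ℝ), x₀), c₀) r := by
      have ht := (hsmall t x).1 htx
      rw [Metric.mem_ball, Prod.dist_eq, max_lt_iff]
      constructor
      · rw [Prod.dist_eq, max_lt_iff]
        refine ⟨?_, ht.2.trans_le (min_le_right _ _)⟩
        simp only [dist_zero_right, norm_mul, Real.norm_eq_abs, abs_of_nonneg s.2.1]
        exact (mul_le_of_le_one_right (abs_nonneg t) s.2.2).trans_lt
          (ht.1.trans_le (min_le_right _ _))
      · have := htx'.2.2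
        rw [ContinuousMap.dist_lt_iff hr] at this
        change dist η c₀ < r
        rw [ContinuousMap.dist_lt_iff hr]
        exact fun τ => this _
    have := (hru _ hball).1 hηG
    simp only at this
    rw [this]
    simp [hη]
  -- The flow at time `t` is the endpoint of the unit-time curve for the field scaled by `t`.
  refine ⟨δ, hδpos, fun p => ψ p 1, ?_⟩
  have hint : ∀ t x, (t, x) ∈ Metric.ball ((0 : ℝ), x₀) δ →
      ψ (t, x) 1 = x + ∫ τ in (0 : ℝ)..t, f (ψ (τ, x) 1) := by
    intro t x htx
    have htx' := hall _ (Metric.ball_subset_ball (min_le_left _ _) htx)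
    have h1 := (integralEquation_eq_zero_iff hf.continuous t x _).1 htx'.2.1 1
    rw [h1]
    have h3 := intervalIntegral.smul_integral_comp_mul_left (a := 0) (b := 1)
          (fun τ => f (ψ (τ, x) 1)) t
    rw [mul_zero, mul_one] at h3
    rw [← h3]
    congr 2
    refine intervalIntegral.integral_congr fun σ hσ => ?_
    rw [Set.uIcc_of_le (by simp)] at hσ
    have hσ' : σ ∈ Set.Icc (0 : ℝ) 1 := by simpa using hσ
    rw [Set.IccExtend_of_mem _ _ hσ', ← hscale t x htx ⟨σ, hσ'⟩]
  have hsm : ∀ p ∈ Metric.ball ((0 : ℝ), x₀) δ, ContDiffAt ℝ ∞ (fun p => ψ p 1) p := by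
    intro p hp
    have h1 := (hall _ (Metric.ball_subset_ball (min_le_left _ _) hp)).1
    exact (ContinuousMap.evalCLM ℝ (1 : unitInterval)).contDiff.contDiffAt.comp p h1
  rintro ⟨t, x⟩ hp
  refine ⟨hsm _ hp, ?_, ?_⟩
  · have h0 : ((0 : ℝ), x) ∈ Metric.ball ((0 : ℝ), x₀) δ :=
      (hsmall 0 x).2 ⟨by simpa using hδpos, ((hsmall t x).1 hp).2⟩
    simpa using hint 0 x h0
  · have hx := ((hsmall t x).1 hp).2
    have hmem : ∀ τ ∈ Metric.ball (0 : ℝ) δ, (τ, x) ∈ Metric.ball ((0 : ℝ), x₀) δ := by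
      intro τ hτ
      rw [mem_ball_zero_iff] at hτ
      exact (hsmall τ x).2 ⟨hτ, hx⟩
    have ht : t ∈ Metric.ball (0 : ℝ) δ := by
      rw [mem_ball_zero_iff]; exact ((hsmall t x).1 hp).1
    have hcont : ContinuousOn (fun τ => f (ψ (τ, x) 1)) (Metric.ball 0 δ) := by
      intro τ hτ
      refine ContinuousAt.continuousWithinAt ?_
      refine hf.continuous.continuousAt.comp ?_
      exact ContinuousAt.comp (f := fun τ : ℝ => (τ, x)) (g := fun p => ψ p 1)
        (hsm _ (hmem τ hτ)).continuousAt (by fun_prop)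
    have hseg : Set.uIcc 0 t ⊆ Metric.ball (0 : ℝ) δ :=
      ((convex_ball (0 : ℝ) δ).ordConnected).uIcc_subset (Metric.mem_ball_self hδpos) ht
    have hderiv : HasDerivAt (fun t => ∫ τ in (0 : ℝ)..t, f (ψ (τ, x) 1)) (f (ψ (t, x) 1)) t :=
      intervalIntegral.integral_hasDerivAt_right
        (hcont.mono hseg).intervalIntegrable
        (hcont.stronglyMeasurableAtFilter Metric.isOpen_ball t ht)
        (hcont.continuousAt (Metric.isOpen_ball.mem_nhds ht))
    refine (hderiv.const_add x).congr_of_eventuallyEq ?_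
    filter_upwards [Metric.isOpen_ball.mem_nhds ht] with τ hτ
    exact hint τ x (hmem τ hτ)

end Flow

section Components

variable {E F : Type*} [NormedAddCommGroup E] [NormedSpace ℝ E]
  [NormedAddCommGroup F] [NormedSpace ℝ F]

theorem HasDerivAt.fst_comp {f : ℝ → E × F} {f' : E × F} {t : ℝ} (h : HasDerivAt f f' t) :
    HasDerivAt (fun s => (f s).1) f'.1 t :=
  (ContinuousLinearMap.fst ℝ E F).hasFDerivAt.comp_hasDerivAt t h

theorem HasDerivAt.snd_comp {f : ℝ → E × F} {f' : E × F} {t : ℝ} (h : HasDerivAt f f' t) :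
    HasDerivAt (fun s => (f s).2) f'.2 t :=
  (ContinuousLinearMap.snd ℝ E F).hasFDerivAt.comp_hasDerivAt t h

end Components

/-! ### Transport along one nonvanishing vector field. -/

section Gauge

variable {E F : Type u} [NormedAddCommGroup E] [NormedSpace ℝ E]
  [NormedAddCommGroup F] [NormedSpace ℝ F]

/-- A function that is smooth on an open set agrees near any point of it with a function that is
smooth everywhere. -/
theorem ContDiffOn.exists_contDiff_eventuallyEq {F : Type*} [NormedAddCommGroup F]
    [NormedSpace ℝ F] [FiniteDimensional ℝ E] {f : E → F} {U : Set E}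
    (hf : ContDiffOn ℝ ∞ f U) (hU : IsOpen U) {z₀ : E} (hz₀ : z₀ ∈ U) :
    ∃ g : E → F, ContDiff ℝ ∞ g ∧ g =ᶠ[𝓝 z₀] f := by
  obtain ⟨r, hr, hrU⟩ := Metric.isOpen_iff.1 hU z₀ hz₀
  let c : ContDiffBump z₀ := ⟨r / 4, r / 2, by positivity, by linarith⟩
  refine ⟨fun z => c z • f z, contDiff_iff_contDiffAt.2 fun z => ?_, ?_⟩
  · by_cases hz : z ∈ U
    · exact c.contDiffAt.smul (hf.contDiffAt (hU.mem_nhds hz))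
    · have hz' : z ∉ tsupport c := by
        rw [c.tsupport_eq]
        intro h
        refine hz (hrU ((Metric.mem_closedBall.1 h).trans_lt ?_))
        change r / 2 < r
        linarith
      have h0 : (fun z => c z • f z) =ᶠ[𝓝 z] fun _ => 0 := by
        filter_upwards [notMem_tsupport_iff_eventuallyEq.1 hz'] with y hy
        simp [hy]
      exact contDiffAt_const.congr_of_eventuallyEq h0
  · filter_upwards [c.eventuallyEq_one] with z hz
    simp [hz]

/-- A linear transport equation along a nonvanishing vector field has smooth fundamental
solutions. -/
theorem exists_transport_along_field [CompleteSpace E] [CompleteSpace F] {Y : E → E}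
    {A : E → F →L[ℝ] F}
    (hY : ContDiff ℝ ∞ Y) (hA : ContDiff ℝ ∞ A) (z₀ : E) (hY₀ : Y z₀ ≠ 0) :
    ∃ B : E → F →L[ℝ] F, B z₀ = .id ℝ F ∧ ∀ᶠ z in 𝓝 z₀, ContDiffAt ℝ ∞ B z ∧
      fderiv ℝ B z (Y z) = -(A z ∘L B z) := by
  obtain ⟨l, -, hl⟩ := exists_dual_vector ℝ (Y z₀) (by simpa using hY₀)
  -- The normalised functional splits `E` as the line of `Y z₀` plus the transversal hyperplane `ker
  -- l`.
  obtain ⟨l, hl⟩ : ∃ l : E →L[ℝ] ℝ, l (Y z₀) = 1 := by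
    refine ⟨‖Y z₀‖⁻¹ • l, ?_⟩
    have : ‖Y z₀‖ ≠ 0 := norm_ne_zero_iff.2 hY₀
    simp only [smul_apply, hl, smul_eq_mul]
    exact inv_mul_cancel₀ this
  -- The base flow and the linear equation over it form one autonomous system.
  set f : E × (F →L[ℝ] F) → E × (F →L[ℝ] F) := fun q => (Y q.1, -(A q.1 ∘L q.2)) with hf
  have hfs : ContDiff ℝ ∞ f :=
    (hY.comp contDiff_fst).prodMk ((hA.comp contDiff_fst).clm_comp contDiff_snd).neg
  obtain ⟨δ, hδ, φ, hφ⟩ := exists_smooth_flow hfs (z₀, .id ℝ F)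
  -- Flow-box coordinates: start on the hyperplane `z₀ + ker l` with the identity operator, and flow
  -- for time `l w`. Translation of `w` along `Y z₀` is then translation of time.
  set ι : E → ℝ × (E × (F →L[ℝ] F)) := fun w => (l w, (z₀ + (w - l w • Y z₀), .id ℝ F)) with hι
  have hιs : ContDiff ℝ ∞ ι := by
    refine l.contDiff.prodMk ((contDiff_const.add (contDiff_id.sub
      (l.contDiff.smul contDiff_const))).prodMk contDiff_const)
  have hι0 : ι 0 = (0, (z₀, .id ℝ F)) := by simp [hι]
  set β : E → E × (F →L[ℝ] F) := fun w => φ (ι w) with hβ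
  have hmem : ∀ᶠ w in 𝓝 (0 : E), ι w ∈ Metric.ball ((0 : ℝ), (z₀, .id ℝ F)) δ := by
    refine hιs.continuous.continuousAt.eventually ?_
    rw [hι0]
    exact Metric.ball_mem_nhds _ hδ
  have hβs : ∀ᶠ w in 𝓝 (0 : E), ContDiffAt ℝ ∞ β w := by
    filter_upwards [hmem] with w hw
    exact (hφ _ hw).1.comp w hιs.contDiffAt
  have hβY : ∀ᶠ w in 𝓝 (0 : E), HasDerivAt (fun t : ℝ => β (w + t • Y z₀)) (f (β w)) 0 := by
    filter_upwards [hmem] with w hw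
    have h1 := (hφ _ hw).2.2
    have h2 : ∀ t : ℝ, β (w + t • Y z₀) = φ ((ι w).1 + t, (ι w).2) := by
      intro t
      simp only [hβ, hι, map_add, map_smul, hl, smul_eq_mul, mul_one, add_smul]
      congr 4
      abel
    simp only [h2]
    have h3 : HasDerivAt (fun t => φ (t, (ι w).2)) (f (φ (ι w))) ((ι w).1 + 0) := by
      rwa [add_zero]
    exact h3.comp_const_add _ _
  have hβ0 : β 0 = (z₀, .id ℝ F) := by
    have := (hφ _ hmem.self_of_nhds).2.1
    rw [hι0] at this
    simpa [hβ, hι0] using this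
  set Ψ : E → E := fun w => (β w).1 with hΨ
  have hΨs : ∀ᶠ w in 𝓝 (0 : E), ContDiffAt ℝ ∞ Ψ w :=
    hβs.mono fun w hw => contDiffAt_fst.comp w hw
  have hΨ0 : Ψ 0 = z₀ := by simp [hΨ, hβ0]
  -- On `Y z₀` this is the flow equation at time zero; on `ker l` the time is zero and `Ψ` is a
  -- translation.
  have hΨ' : HasFDerivAt Ψ ((ContinuousLinearEquiv.refl ℝ E : E ≃L[ℝ] E) : E →L[ℝ] E) 0 := by
    have h1 : HasFDerivAt Ψ (fderiv ℝ Ψ 0) 0 :=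
      (hΨs.self_of_nhds.differentiableAt (by simp)).hasFDerivAt
    have h2 : fderiv ℝ Ψ 0 = ((ContinuousLinearEquiv.refl ℝ E : E ≃L[ℝ] E) : E →L[ℝ] E) := by
      ext w
      have hdecomp : w = l w • Y z₀ + (w - l w • Y z₀) := by abel
      have hker : l (w - l w • Y z₀) = 0 := by simp [hl]
      have e1 : fderiv ℝ Ψ 0 (Y z₀) = Y z₀ := by
        have h3 := (hβY.self_of_nhds).fst_comp
        rw [hβ0] at h3
        have h4 : HasDerivAt (fun t : ℝ => (0 : E) + t • Y z₀) (Y z₀) 0 := by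
          simpa using ((hasDerivAt_id (0 : ℝ)).smul_const (Y z₀)).const_add (0 : E)
        have h5 : HasFDerivAt Ψ (fderiv ℝ Ψ 0) ((0 : E) + (0 : ℝ) • Y z₀) := by simpa using h1
        have h6 := h5.comp_hasDerivAt (0 : ℝ) h4
        exact h6.unique h3
      have e2 : ∀ v, l v = 0 → fderiv ℝ Ψ 0 v = v := by
        intro v hv
        have h4 : HasDerivAt (fun t : ℝ => t • v) v 0 := by
          simpa using (hasDerivAt_id (0 : ℝ)).smul_const v
        have h5 : HasFDerivAt Ψ (fderiv ℝ Ψ 0) ((0 : ℝ) • v) := by simpa using h1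
        have h6 : HasDerivAt (fun t : ℝ => Ψ (t • v)) v 0 := by
          refine (h4.const_add z₀).congr_of_eventuallyEq ?_
          have hc : Filter.Tendsto (fun t : ℝ => t • v) (𝓝 0) (𝓝 0) := by
            simpa using h4.continuousAt.tendsto
          filter_upwards [hc.eventually hmem] with t ht
          have := (hφ _ ht).2.1
          simp only [hι, map_smul, hv, smul_zero, zero_smul, sub_zero] at this
          simp [hΨ, hβ, hι, hv, this]
        have h7 := h5.comp_hasDerivAt (0 : ℝ) h4
        exact h7.unique h6
      rw [hdecomp, map_add, map_smul, e1, e2 _ hker]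
      rfl
    rwa [h2] at h1
  set g := hΨs.self_of_nhds.toOpenPartialHomeomorph Ψ hΨ' (by simp) with hg
  have hgc : (g : E → E) = Ψ := rfl
  have h0s : (0 : E) ∈ g.source :=
    hΨs.self_of_nhds.mem_toOpenPartialHomeomorph_source hΨ' (by simp)
  have hz₀t : z₀ ∈ g.target := by
    have := g.map_source h0s
    rwa [hgc, hΨ0] at this
  have hgz : g.symm z₀ = 0 := by
    have := g.left_inv h0s
    rwa [hgc, hΨ0] at this
  have hgcont : Filter.Tendsto g.symm (𝓝 z₀) (𝓝 0) := by
    have := g.continuousAt_symm hz₀t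
    rwa [ContinuousAt, hgz] at this
  have hinv : ∀ᶠ w in 𝓝 (0 : E), ∃ e : E ≃L[ℝ] E, HasFDerivAt Ψ (e : E →L[ℝ] E) w := by
    have hc : ContinuousAt (fderiv ℝ Ψ) 0 :=
      (hΨs.self_of_nhds.fderiv_right (m := ∞) (by simp)).continuousAt
    have hn := (ContinuousLinearEquiv.refl ℝ E).nhds
    rw [← hΨ'.fderiv] at hn
    filter_upwards [hc hn, hΨs] with w ⟨e, he⟩ hw
    refine ⟨e, ?_⟩
    rw [he]
    exact (hw.differentiableAt (by simp)).hasFDerivAt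
  -- The operator component read through the inverse flow box; differentiating along flow lines
  -- gives the transport equation.
  refine ⟨fun z => (β (g.symm z)).2, by simp [hgz, hβ0], ?_⟩
  filter_upwards [hgcont.eventually hinv, hgcont.eventually hΨs, hgcont.eventually hβs,
    hgcont.eventually hβY, g.open_target.mem_nhds hz₀t] with z ⟨e, he⟩ hzΨ hzβ hzY hzt
  have hsymm : ContDiffAt ℝ ∞ g.symm z := g.contDiffAt_symm hzt he hzΨ
  have hB : ContDiffAt ℝ ∞ (fun z => (β (g.symm z)).2) z :=
    contDiffAt_snd.comp z (hzβ.comp z hsymm)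
  refine ⟨hB, ?_⟩
  set w := g.symm z with hw
  have hws : w ∈ g.source := g.map_target hzt
  have hΨw : Ψ w = z := g.right_inv hzt
  have h1 := hzY.fst_comp
  have h2 := hzY.snd_comp
  have h3 : HasFDerivAt (fun z => (β (g.symm z)).2) (fderiv ℝ (fun z => (β (g.symm z)).2) z)
      (Ψ (w + (0 : ℝ) • Y z₀)) := by
    simpa [hΨw] using (hB.differentiableAt (by simp)).hasFDerivAt
  have h4 := h3.comp_hasDerivAt (f := fun t : ℝ => Ψ (w + t • Y z₀)) (0 : ℝ) h1
  have h5 : HasDerivAt ((fun z => (β (g.symm z)).2) ∘ fun t : ℝ => Ψ (w + t • Y z₀))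
      (f (β w)).2 0 := by
    refine h2.congr_of_eventuallyEq ?_
    have hc : Filter.Tendsto (fun t : ℝ => w + t • Y z₀) (𝓝 0) (𝓝 w) := by
      have : Continuous fun t : ℝ => w + t • Y z₀ := by fun_prop
      simpa using this.tendsto 0
    filter_upwards [hc.eventually (g.open_source.mem_nhds hws)] with t ht
    have := g.left_inv ht
    rw [hgc] at this
    simp [this]
  have h6 := h4.unique h5
  have hfst : (β w).1 = z := hΨw
  simpa [hf, hfst] using h6

/-- Grönwall's inequality, with `K` a bound for `‖L‖` on the compact interval. -/
theorem eq_zero_of_linear_ode {F : Type*} [NormedAddCommGroup F] [NormedSpace ℝ F]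
    {y : ℝ → F} {L : ℝ → F →L[ℝ] F} {b : ℝ} (hb : 0 ≤ b)
    (hL : ContinuousOn L (Set.Icc 0 b))
    (hy : ∀ t ∈ Set.Icc 0 b, HasDerivAt y (L t (y t)) t) (h0 : y 0 = 0) : y b = 0 := by
  obtain ⟨K, hK⟩ := isCompact_Icc.exists_bound_of_continuousOn hL
  refine eq_zero_of_abs_deriv_le_mul_abs_self_of_eq_zero_right (a := 0) (b := b) (K := K)
    (f' := fun t => L t (y t))
    (fun t ht => (hy t ht).continuousAt.continuousWithinAt)
    (fun t ht => (hy t (Set.Ico_subset_Icc_self ht)).hasDerivWithinAt) h0 ?_ b ⟨hb, le_rfl⟩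
  intro t ht
  exact (L t).le_of_opNorm_le (hK t (Set.Ico_subset_Icc_self ht)) _

end Gauge

/-! ### Parallel transport for flat connection forms. -/

section Flat

variable {E 𝔸 : Type u} [NormedAddCommGroup E] [NormedSpace ℝ E]
  [NormedRing 𝔸] [NormedAlgebra ℝ 𝔸]

/-- Radial parallel transport: the fundamental solution, along the rays issuing from `z₀`, of the
transport equation of the connection form `Γ`. -/
theorem exists_radial_transport [CompleteSpace E] [CompleteSpace 𝔸] {Γ : E → E →L[ℝ] 𝔸}
    (hΓ : ContDiff ℝ ∞ Γ) (z₀ : E) :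
    ∃ δ > 0, ∃ β : ℝ × E → 𝔸, ∀ t v, |t| < δ → ‖v‖ < δ →
      ContDiffAt ℝ ∞ β (t, v) ∧ β (0, v) = 1 ∧
        HasDerivAt (fun s => β (s, v)) (-(Γ (z₀ + t • v) v * β (t, v))) t := by
  -- The state is (position, velocity, transport). Adding the velocity makes the system autonomous
  -- and turns the direction of the ray into an initial value, so dependence on it is smooth.
  set f : E × E × 𝔸 → E × E × 𝔸 :=
    fun q => (q.2.1, 0, -(Γ q.1 q.2.1 * q.2.2)) with hf
  have hfs : ContDiff ℝ ∞ f := by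
    refine (contDiff_fst.comp contDiff_snd).prodMk (contDiff_const.prodMk ?_)
    exact (((hΓ.comp contDiff_fst).clm_apply (contDiff_fst.comp contDiff_snd)).mul
      (contDiff_snd.comp contDiff_snd)).neg
  obtain ⟨δ, hδ, φ, hφ⟩ := exists_smooth_flow hfs (z₀, 0, 1)
  set ι : ℝ × E → ℝ × (E × E × 𝔸) := fun p => (p.1, (z₀, p.2, 1)) with hι
  have hιs : ContDiff ℝ ∞ ι :=
    contDiff_fst.prodMk (contDiff_const.prodMk (contDiff_snd.prodMk contDiff_const))
  have hmem : ∀ t v, |t| < δ → ‖v‖ < δ →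
      ι (t, v) ∈ Metric.ball ((0 : ℝ), (z₀, (0 : E), 1)) δ := by
    intro t v ht hv
    simp [hι, Prod.dist_eq, ht, hv]
  refine ⟨δ, hδ, fun p => (φ (ι p)).2.2, fun t v ht hv => ?_⟩
  have h1 := hφ _ (hmem t v ht hv)
  have hab : ∀ s ∈ Set.Ioo (-δ) δ, (φ (ι (s, v))).2.1 = v ∧ (φ (ι (s, v))).1 = z₀ + s • v := by
    have hconv : Convex ℝ (Set.Ioo (-δ) δ) := convex_Ioo _ _
    have h0 : (0 : ℝ) ∈ Set.Ioo (-δ) δ := ⟨by linarith, hδ⟩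
    have hd : ∀ s ∈ Set.Ioo (-δ) δ, HasDerivAt (fun s => φ (ι (s, v))) (f (φ (ι (s, v)))) s :=
      fun s hs => (hφ _ (hmem s v (abs_lt.2 hs) hv)).2.2
    have hi : φ (ι (0, v)) = (z₀, v, 1) := h1.2.1
    have hv' : ∀ s ∈ Set.Ioo (-δ) δ, (φ (ι (s, v))).2.1 = v := by
      intro s hs
      have := hconv.norm_image_sub_le_of_norm_hasDerivWithin_le (C := 0)
        (f := fun s => (φ (ι (s, v))).2.1) (f' := fun s => (f (φ (ι (s, v)))).2.1)
        (fun s hs => (hd s hs).snd_comp.fst_comp.hasDerivWithinAt) (fun s _ => by simp [hf]) h0 hs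
      simpa [hi, sub_eq_zero] using this
    refine fun s hs => ⟨hv' s hs, ?_⟩
    have := hconv.norm_image_sub_le_of_norm_hasDerivWithin_le (C := 0)
      (f := fun s => (φ (ι (s, v))).1 - s • v) (f' := fun s => (f (φ (ι (s, v)))).1 - (1 : ℝ) • v)
      (fun s hs => ((hd s hs).fst_comp.sub ((hasDerivAt_id s).smul_const v)).hasDerivWithinAt)
      (fun s hs => by simp [hf, hv' s hs]) h0 hs
    simp only [hi, zero_mul, norm_le_zero_iff, zero_smul, sub_zero] at this
    rw [sub_eq_zero, sub_eq_iff_eq_add] at this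
    exact this
  refine ⟨?_, ?_, ?_⟩
  · exact contDiffAt_snd.comp _ (contDiffAt_snd.comp _ (h1.1.comp _ hιs.contDiffAt))
  · have : φ (ι (0, v)) = (z₀, v, 1) := h1.2.1
    simp [this]
  · have h2 := h1.2.2.snd_comp.snd_comp
    obtain ⟨ha, hb⟩ := hab t (abs_lt.1 ht)
    simp only [hf] at h2
    rw [ha, hb] at h2
    exact h2

/-- Mixed second derivatives along two curves through a point agree. -/
theorem ContDiffAt.hasDerivAt_fderiv_swap {P G : Type*} [NormedAddCommGroup P] [NormedSpace ℝ P]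
    [NormedAddCommGroup G] [NormedSpace ℝ G] {β : P → G} {p a b : P} (hβ : ContDiffAt ℝ ∞ β p)
    {c c' : ℝ → P} {s s' : ℝ} (hc : HasDerivAt c a s) (hcs : c s = p) (hc' : HasDerivAt c' b s')
    (hcs' : c' s' = p) {m : G} (hm : HasDerivAt (fun τ => fderiv ℝ β (c' τ) a) m s') :
    HasDerivAt (fun τ => fderiv ℝ β (c τ) b) m s := by
  have hD : ContDiffAt ℝ ∞ (fderiv ℝ β) p := hβ.fderiv_right (by simp)
  have hD' : HasFDerivAt (fderiv ℝ β) (fderiv ℝ (fderiv ℝ β) p) p :=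
    (hD.differentiableAt (by simp)).hasFDerivAt
  have hsymm : IsSymmSndFDerivAt ℝ β p :=
    hβ.isSymmSndFDerivAt (by simpa using WithTop.coe_le_coe.2 (le_top : (2 : ℕ∞) ≤ ⊤))
  have h1 : HasDerivAt (fun τ => fderiv ℝ β (c τ) b) (fderiv ℝ (fderiv ℝ β) p a b) s := by
    subst hcs
    simpa using (hD'.comp_hasDerivAt s hc).clm_apply (hasDerivAt_const s b)
  have h2 : HasDerivAt (fun τ => fderiv ℝ β (c' τ) a) (fderiv ℝ (fderiv ℝ β) p b a) s' := by
    subst hcs'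
    simpa using (hD'.comp_hasDerivAt s' hc').clm_apply (hasDerivAt_const s' a)
  rwa [hsymm.eq, h2.unique hm] at h1

/-- The derivative of `Γ (c τ) (u τ)` for a field `Γ` of operators and curves `c`, `u`. -/
theorem HasFDerivAt.hasDerivAt_clm_apply_curve {P V G : Type*} [NormedAddCommGroup P]
    [NormedSpace ℝ P] [NormedAddCommGroup V] [NormedSpace ℝ V] [NormedAddCommGroup G]
    [NormedSpace ℝ G] {Γ : P → V →L[ℝ] G} {Γ' : P →L[ℝ] V →L[ℝ] G} {p : P}
    (hΓ : HasFDerivAt Γ Γ' p) {c : ℝ → P} {u : ℝ → V} {c' : P} {u' : V} {s : ℝ}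
    (hc : HasDerivAt c c' s) (hcs : c s = p) (hu : HasDerivAt u u' s) :
    HasDerivAt (fun τ => Γ (c τ) (u τ)) (Γ' c' (u s) + Γ p u') s := by
  subst hcs
  exact (hΓ.comp_hasDerivAt s hc).clm_apply hu

/-- A flat connection form has, locally, a smooth parallel fundamental solution. -/
theorem exists_parallel_of_flat [CompleteSpace E] [CompleteSpace 𝔸] {Γ : E → E →L[ℝ] 𝔸}
    (hΓ : ContDiff ℝ ∞ Γ) (z₀ : E)
    (hflat : ∀ᶠ z in 𝓝 z₀, ∀ v w, fderiv ℝ Γ z v w - fderiv ℝ Γ z w v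
      + Γ z v * Γ z w - Γ z w * Γ z v = 0) :
    ∃ B : E → 𝔸, B z₀ = 1 ∧ ∀ᶠ z in 𝓝 z₀, ContDiffAt ℝ ∞ B z ∧
      ∀ v, fderiv ℝ B z v = -(Γ z v * B z) := by
  obtain ⟨δ, hδ, β, hβ⟩ := exists_radial_transport hΓ z₀
  obtain ⟨r, hr, hflat⟩ := Metric.eventually_nhds_iff_ball.1 hflat
  -- Transport is available only for times below `δ`, so `z` is reached at time `b` with velocity
  -- `b⁻¹ • (z - z₀)`. The bound `b < 1` keeps the ray inside the ball where the curvature vanishes.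
  set b := min δ 1 / 2 with hb
  have hm : 0 < min δ 1 := lt_min hδ one_pos
  have hb0 : 0 < b := by positivity
  have hbδ : b < δ := by have := min_le_left δ 1; linarith
  have hb1 : b < 1 := by have := min_le_right δ 1; linarith
  have habs : ∀ t ∈ Set.Icc 0 b, |t| < δ := fun t ht => by
    rw [abs_of_nonneg ht.1]; exact ht.2.trans_lt hbδ
  -- the derivative of radial transport in the direction of the parameter
  have key : ∀ v w, ‖v‖ < min δ r →
      fderiv ℝ β (b, v) (0, w) + Γ (z₀ + b • v) (b • w) * β (b, v) = 0 := by
    intro v w hv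
    have hvδ : ‖v‖ < δ := hv.trans_le (min_le_left _ _)
    have hlineE : HasDerivAt (fun s : ℝ => v + s • w) w 0 := by
      simpa using ((hasDerivAt_id (0 : ℝ)).smul_const w).const_add v
    have hsmall : ∀ᶠ s in 𝓝 (0 : ℝ), ‖v + s • w‖ < δ := by
      have hc : Continuous fun s : ℝ => ‖v + s • w‖ := by fun_prop
      exact hc.continuousAt.eventually (gt_mem_nhds (by simpa using hvδ))
    have hline : ∀ t, HasDerivAt (fun s : ℝ => (t, v + s • w)) ((0 : ℝ), w) 0 := fun t =>
      (hasDerivAt_const _ _).prodMk hlineE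
    -- The quantity `y` is the covariant derivative of `β` transverse to the ray. It vanishes at
    -- time `0`, and flatness makes it solve the homogeneous equation `y' = -Γ(v) y`.
    refine eq_zero_of_linear_ode
      (y := fun t => fderiv ℝ β (t, v) (0, w) + Γ (z₀ + t • v) (t • w) * β (t, v))
      (L := fun t => -(ContinuousLinearMap.mul ℝ 𝔸 (Γ (z₀ + t • v) v))) hb0.le ?_ ?_ ?_
    · have h1 : Continuous fun t : ℝ => Γ (z₀ + t • v) v :=
        (hΓ.continuous.comp (by fun_prop)).clm_apply continuous_const
      exact ((ContinuousLinearMap.mul ℝ 𝔸).continuous.comp h1).neg.continuousOn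
    · intro t ht
      have htδ := habs t ht
      obtain ⟨hs, -, hd⟩ := hβ t v htδ hvδ
      have hβ' : HasFDerivAt β (fderiv ℝ β (t, v)) (t, v) :=
        (hs.differentiableAt (by simp)).hasFDerivAt
      have hΓ' : HasFDerivAt Γ (fderiv ℝ Γ (z₀ + t • v)) (z₀ + t • v) :=
        (hΓ.differentiable (by simp) _).hasFDerivAt
      -- mixed second derivative
      have hpartial : ∀ u, ‖u‖ < δ → fderiv ℝ β (t, u) (1, 0) =
          -(Γ (z₀ + t • u) u * β (t, u)) := by
        intro u hu
        obtain ⟨hs', -, hd'⟩ := hβ t u htδ hu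
        have h1 : HasFDerivAt β (fderiv ℝ β (t, u)) (t, u) :=
          (hs'.differentiableAt (by simp)).hasFDerivAt
        have h2 : HasDerivAt (fun s : ℝ => (s, u)) ((1 : ℝ), (0 : E)) t :=
          (hasDerivAt_id t).prodMk (hasDerivAt_const _ _)
        exact (h1.comp_hasDerivAt t h2).unique hd'
      have hy1 : HasDerivAt (fun t => fderiv ℝ β (t, v) (0, w))
          (-((fderiv ℝ Γ (z₀ + t • v) (t • w) v + Γ (z₀ + t • v) w) * β (t, v)
            + Γ (z₀ + t • v) v * fderiv ℝ β (t, v) (0, w))) t := by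
        refine hs.hasDerivAt_fderiv_swap (c := fun s => (s, v)) (a := (1, 0))
          (c' := fun s => (t, v + s • w)) (s' := 0)
          ((hasDerivAt_id t).prodMk (hasDerivAt_const _ _)) rfl (hline t) (by simp) ?_
        have h6 := hΓ'.hasDerivAt_clm_apply_curve ((hlineE.const_smul t).const_add z₀) (by simp)
          hlineE
        have h7 : HasFDerivAt β (fderiv ℝ β (t, v)) (t, v + (0 : ℝ) • w) := by simpa using hβ'
        have h8 := (h6.mul (h7.comp_hasDerivAt (0 : ℝ) (hline t))).neg
        refine (h8.congr_deriv ?_).congr_of_eventuallyEq ?_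
        · simp
        · filter_upwards [hsmall] with s hs
          exact hpartial _ hs
      have hy2 : HasDerivAt (fun t => Γ (z₀ + t • v) (t • w) * β (t, v))
          ((fderiv ℝ Γ (z₀ + t • v) v (t • w) + Γ (z₀ + t • v) w) * β (t, v)
            + Γ (z₀ + t • v) (t • w) * (-(Γ (z₀ + t • v) v * β (t, v)))) t := by
        have hl1 : HasDerivAt (fun t : ℝ => z₀ + t • v) v t := by
          simpa using ((hasDerivAt_id t).smul_const v).const_add z₀
        have hl2 : HasDerivAt (fun t : ℝ => t • w) w t := by
          simpa using (hasDerivAt_id t).smul_const w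
        exact (hΓ'.hasDerivAt_clm_apply_curve hl1 rfl hl2).mul hd
      refine (hy1.add hy2).congr_deriv ?_
      have hz : z₀ + t • v ∈ Metric.ball z₀ r := by
        rw [mem_ball_iff_norm, add_sub_cancel_left, norm_smul, Real.norm_of_nonneg ht.1]
        calc t * ‖v‖ ≤ 1 * ‖v‖ := by gcongr; exact ht.2.trans hb1.le
          _ < r := by rw [one_mul]; exact hv.trans_le (min_le_right _ _)
      -- The failure of `y' = -Γ(v) y` is exactly the curvature on the pair `(v, t • w)` multiplied
      -- by `β`.
      have hc := congrArg (fun T : 𝔸 => T * β (t, v)) (hflat _ hz v (t • w))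
      simp only [zero_mul] at hc
      simp only [neg_apply, ContinuousLinearMap.mul_apply']
      rw [← sub_eq_zero, ← hc]
      noncomm_ring
    · have h1 : HasFDerivAt β (fderiv ℝ β (0, v)) (0, v + (0 : ℝ) • w) := by
        simpa using ((hβ 0 v (by simpa using hδ) hvδ).1.differentiableAt (by simp)).hasFDerivAt
      have h2 := h1.comp_hasDerivAt (0 : ℝ) (hline 0)
      have h3 : HasDerivAt (β ∘ fun s : ℝ => ((0 : ℝ), v + s • w)) 0 0 := by
        refine (hasDerivAt_const (0 : ℝ) (1)).congr_of_eventuallyEq ?_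
        filter_upwards [hsmall] with s hs
        exact (hβ 0 _ (by simpa using hδ) hs).2.1
      simp [h2.unique h3]
  have hev : ∀ᶠ z in 𝓝 z₀, ‖b⁻¹ • (z - z₀)‖ < min δ r := by
    have hc : Continuous fun z : E => ‖b⁻¹ • (z - z₀)‖ := by fun_prop
    exact hc.continuousAt.eventually (gt_mem_nhds (by simpa using ⟨hδ, hr⟩))
  have hbabs : |b| < δ := habs b ⟨hb0.le, le_rfl⟩
  refine ⟨fun z => β (b, b⁻¹ • (z - z₀)), ?_, ?_⟩
  · -- along the constant ray the transport is trivial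
    have h1 := (convex_Icc (0 : ℝ) b).norm_image_sub_le_of_norm_hasDerivWithin_le (C := 0)
      (f := fun s => β (s, (0 : E)))
      (fun s hs => (hβ s 0 (habs s hs) (by simpa using hδ)).2.2.hasDerivWithinAt)
      (fun s _ => by simp) (Set.left_mem_Icc.2 hb0.le) (Set.right_mem_Icc.2 hb0.le)
    have h2 : β (0, (0 : E)) = 1 := (hβ b 0 hbabs (by simpa using hδ)).2.1
    simpa [sub_eq_zero, h2] using h1
  · filter_upwards [hev] with z hz
    have hs := (hβ b _ hbabs (hz.trans_le (min_le_left _ _))).1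
    have hι : HasFDerivAt (fun z : E => (b, b⁻¹ • (z - z₀)))
        ((0 : E →L[ℝ] ℝ).prod (b⁻¹ • ContinuousLinearMap.id ℝ E)) z :=
      (hasFDerivAt_const b z).prodMk (((hasFDerivAt_id z).sub_const z₀).const_smul b⁻¹)
    have hιs : ContDiff ℝ ∞ (fun z : E => (b, b⁻¹ • (z - z₀))) := by fun_prop
    refine ⟨hs.comp z hιs.contDiffAt, fun w => ?_⟩
    have hd := ((hs.differentiableAt (by simp)).hasFDerivAt.comp z hι).fderiv
    -- The factor `b⁻¹` comes from differentiating `b⁻¹ • (z - z₀)`; it cancels the `b` in the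
    -- connection term.
    have hk := key _ (b⁻¹ • w) hz
    rw [smul_smul, smul_smul, mul_inv_cancel₀ hb0.ne', one_smul, one_smul, add_sub_cancel] at hk
    have hd' := congrArg (fun T : E →L[ℝ] 𝔸 => T w) hd
    refine hd'.trans ?_
    rw [← sub_eq_zero, sub_neg_eq_add, ← hk]
    simp

end Flat

/-! ### Stable distributions and parallel frames, in coordinates. -/

section ParallelFrame

variable {E V : Type*} [NormedAddCommGroup E] [NormedSpace ℝ E]
  [NormedAddCommGroup V] [NormedSpace ℝ V]

theorem eventually_isInvertible_of_eq_id {X : Type*} [TopologicalSpace X] [CompleteSpace V]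
    {A : X → V →L[ℝ] V} {z₀ : X} (hA : ContinuousAt A z₀) (hA₀ : A z₀ = .id ℝ V) : ∀ᶠ z in 𝓝 z₀, (A z).IsInvertible := by
  have hn := (ContinuousLinearEquiv.refl ℝ V).nhds
  rw [ContinuousLinearEquiv.coe_refl, ← hA₀] at hn
  filter_upwards [hA hn] with z hz
  exact hz

theorem exists_continuous_leftInverse [FiniteDimensional ℝ E] [FiniteDimensional ℝ V]
    {w : V →L[ℝ] E} (hw : Function.Injective w) : ∃ P : E →L[ℝ] V, P ∘L w = .id ℝ V := by
  obtain ⟨P, hP⟩ := LinearMap.exists_leftInverse_of_injective w.toLinearMap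
    (LinearMap.ker_eq_bot.2 hw)
  exact ⟨LinearMap.toContinuousLinearMap P, by
    ext x; exact congrArg (fun f : V →ₗ[ℝ] V => f x) hP⟩

/-- Suppose that `w` is a local frame of a distribution which is stable, in the directions `L`,
for the connection with connection form `Γ`, and that the connection has parallel frames `B` in
these directions. Then the distribution has a local frame which is parallel in these
directions. -/
theorem exists_parallel_frame_of_stable [FiniteDimensional ℝ E] [FiniteDimensional ℝ V]
    {Γ : E → E →L[ℝ] E →L[ℝ] E} {B : E → E →L[ℝ] E} {w : E → V →L[ℝ] E} {L : E → Set E} {z₀ : E}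
    (hB₀ : B z₀ = .id ℝ E)
    (hB : ∀ᶠ z in 𝓝 z₀, ContDiffAt ℝ ∞ B z ∧ ∀ v ∈ L z, fderiv ℝ B z v = -(Γ z v ∘L B z))
    (hw : ∀ᶠ z in 𝓝 z₀, ContDiffAt ℝ ∞ w z ∧ Function.Injective (w z))
    (hstable : ∀ᶠ z in 𝓝 z₀, ∀ u : E → E,
      (∀ᶠ y in 𝓝 z, ContDiffAt ℝ ∞ u y ∧ u y ∈ (w y).range) →
        ∀ v ∈ L z, fderiv ℝ u z v + Γ z v (u z) ∈ (w z).range) :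
    ∃ w' : E → V →L[ℝ] E, ∀ᶠ z in 𝓝 z₀, ContDiffAt ℝ ∞ w' z ∧ Function.Injective (w' z) ∧
      (w' z).range = (w z).range ∧
        ∀ v ∈ L z, ∀ a, fderiv ℝ w' z v a + Γ z v (w' z a) = 0 := by
  have : CompleteSpace E := FiniteDimensional.complete ℝ E
  have : CompleteSpace V := FiniteDimensional.complete ℝ V
  obtain ⟨P, hP⟩ := exists_continuous_leftInverse hw.self_of_nhds.2
  have hBinv := eventually_isInvertible_of_eq_id hB.self_of_nhds.1.continuousAt hB₀
  -- The frame seen in the gauge, where covariant derivatives along `L` become ordinary ones.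
  set C : E → V →L[ℝ] E := fun z => (B z).inverse ∘L w z with hC
  have hCs : ∀ᶠ z in 𝓝 z₀, ContDiffAt ℝ ∞ C z := by
    filter_upwards [hB, hBinv, hw] with z h1 h2 h3
    exact (h2.contDiffAt_map_inverse.comp z h1.1).clm_comp h3.1
  set Q : E → V →L[ℝ] V := fun z => P ∘L C z with hQ
  have hQs : ∀ᶠ z in 𝓝 z₀, ContDiffAt ℝ ∞ Q z := by
    filter_upwards [hCs] with z h1
    exact contDiffAt_const.clm_comp h1
  have hQ₀ : Q z₀ = .id ℝ V := by
    simp [hQ, hC, hB₀, hP]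
  have hQinv := eventually_isInvertible_of_eq_id hQs.self_of_nhds.continuousAt hQ₀
  have hNs : ∀ᶠ z in 𝓝 z₀, ContDiffAt ℝ ∞ (fun z => (Q z).inverse) z := by
    filter_upwards [hQs, hQinv] with z h1 h2
    exact h2.contDiffAt_map_inverse.comp z h1
  -- The change of frame that makes `P ∘L C'` constant; `w z` and `w z ∘L (Q z).inverse` have the
  -- same range.
  set C' : E → V →L[ℝ] E := fun z => C z ∘L (Q z).inverse with hC'
  have hC's : ∀ᶠ z in 𝓝 z₀, ContDiffAt ℝ ∞ C' z := by
    filter_upwards [hCs, hNs] with z h1 h2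
    exact h1.clm_comp h2
  have hPC' : ∀ᶠ z in 𝓝 z₀, P ∘L C' z = .id ℝ V := by
    filter_upwards [hQinv] with z h1
    rw [hC', ← ContinuousLinearMap.comp_assoc]
    exact h1.self_comp_inverse
  have hw's : ∀ᶠ z in 𝓝 z₀, ContDiffAt ℝ ∞ (fun z => w z ∘L (Q z).inverse) z := by
    filter_upwards [hw, hNs] with z h1 h2
    exact h1.1.clm_comp h2
  have hBC' : ∀ᶠ z in 𝓝 z₀, w z ∘L (Q z).inverse = B z ∘L C' z := by
    filter_upwards [hBinv] with z h1
    ext x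
    simp [hC', hC, h1.self_apply_inverse]
  have hrange : ∀ᶠ z in 𝓝 z₀, (w z ∘L (Q z).inverse).range = (w z).range := by
    filter_upwards [hQinv] with z ⟨e, he⟩
    rw [← he, ContinuousLinearMap.inverse_equiv]
    ext x
    constructor
    · rintro ⟨a, rfl⟩; exact ⟨e.symm a, rfl⟩
    · rintro ⟨a, rfl⟩; exact ⟨e a, by simp⟩
  refine ⟨fun z => w z ∘L (Q z).inverse, ?_⟩
  filter_upwards [hw, hw's, hw's.eventually_nhds, hrange, hrange.eventually_nhds, hstable, hB,
    hBinv, hC's, hBC', hBC'.eventually_nhds, hPC', hPC'.eventually_nhds, hQinv] with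
    z z1 z2 z3 z4 z5 z6 z7 z8 z9 z10 z11 z12 z13 z14
  refine ⟨z2, ?_, z4, fun v hv a => ?_⟩
  · obtain ⟨e, he⟩ := z14
    rw [← he, ContinuousLinearMap.inverse_equiv]
    exact z1.2.comp e.symm.injective
  have hBd : HasFDerivAt B (fderiv ℝ B z) z := (z7.1.differentiableAt (by simp)).hasFDerivAt
  have hC'd : HasFDerivAt C' (fderiv ℝ C' z) z := (z9.differentiableAt (by simp)).hasFDerivAt
  have hfd : fderiv ℝ (fun y => (w y ∘L (Q y).inverse) a) z v =
      fderiv ℝ (fun z => w z ∘L (Q z).inverse) z v a := by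
    rw [fderiv_clm_apply (z2.differentiableAt (by simp)) (differentiableAt_const a)]
    simp
  have hderiv : fderiv ℝ (fun z => w z ∘L (Q z).inverse) z v a
      + Γ z v ((w z ∘L (Q z).inverse) a) = B z (fderiv ℝ C' z v a) := by
    have h0 : HasFDerivAt (fun y => B y (C' y a)) _ z :=
      hBd.clm_apply (hC'd.clm_apply (hasFDerivAt_const a z))
    have h1 := (h0.congr_of_eventuallyEq (f₁ := fun y => (w y ∘L (Q y).inverse) a) (by
      filter_upwards [z11] with y hy
      rw [hy]
      rfl)).fderiv
    rw [← hfd, h1, z10]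
    simp [z7.2 v hv]
  rw [hderiv]
  have hP0 : P (fderiv ℝ C' z v a) = 0 := by
    have h1 : HasFDerivAt (fun y => P (C' y a)) (P ∘L ((fderiv ℝ C' z).flip a)) z :=
      P.hasFDerivAt.comp z (hC'd.clm_apply (hasFDerivAt_const a z) |>.congr_fderiv (by
        ext; simp))
    have h2 : HasFDerivAt (fun y => P (C' y a)) (0 : E →L[ℝ] V) z := by
      refine (hasFDerivAt_const a z).congr_of_eventuallyEq ?_
      filter_upwards [z13] with y hy
      exact congrArg (fun T : V →L[ℝ] V => T a) hy
    have h3 := congrArg (fun T : E →L[ℝ] V => T v) (h1.unique h2)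
    simpa using h3
  -- Stability, applied to a column of the new frame, places `B (dC'(v) a)` in the range of `B C'`.
  -- Since `B` is injective, `dC'(v) a = C' b` for some `b`, and applying `P` gives `b = 0`.
  have hmem := z6 (fun y => (w y ∘L (Q y).inverse) a) (by
    filter_upwards [z3, z5] with y h1 h2
    exact ⟨h1.clm_apply contDiffAt_const, by rw [← h2]; exact ⟨a, rfl⟩⟩) v hv
  rw [hfd, hderiv, ← z4, z10] at hmem
  obtain ⟨b, hb⟩ := hmem
  have hinj : Function.Injective (B z) := by
    obtain ⟨e, he⟩ := z8
    rw [← he]; exact e.injective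
  have hb' : C' z b = fderiv ℝ C' z v a := hinj hb
  have hb0 : b = 0 := by
    have := congrArg (fun T : V →L[ℝ] V => T b) z12
    simp only [ContinuousLinearMap.comp_apply, hb', hP0] at this
    exact this.symm
  rw [← hb', hb0, map_zero, map_zero]

/-- A distribution with a local frame which is parallel in the direction `v` is stable in this
direction. -/
theorem mem_range_of_parallel_frame [FiniteDimensional ℝ E] [FiniteDimensional ℝ V]
    {Γ : E →L[ℝ] E} {w : E → V →L[ℝ] E} {u : E → E} {z v : E}
    (hw : DifferentiableAt ℝ w z) (hinj : Function.Injective (w z))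
    (hu : DifferentiableAt ℝ u z) (hmem : ∀ᶠ y in 𝓝 z, u y ∈ (w y).range)
    (hpar : ∀ a, fderiv ℝ w z v a + Γ (w z a) = 0) :
    fderiv ℝ u z v + Γ (u z) ∈ (w z).range := by
  have : CompleteSpace V := FiniteDimensional.complete ℝ V
  obtain ⟨P, hP⟩ := exists_continuous_leftInverse hinj
  set Q : E → V →L[ℝ] V := fun z => P ∘L w z with hQ
  have hQd : DifferentiableAt ℝ Q z := (differentiableAt_const P).clm_comp hw
  have hQinv := eventually_isInvertible_of_eq_id hQd.continuousAt hP
  -- The coordinates of `u` in the frame, differentiable by this formula. In the product rule for `w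
  -- c`, parallelism cancels the terms with `dw` and `Γ`, leaving `w (dc(v))`.
  set c : E → V := fun y => (Q y).inverse (P (u y)) with hc
  have hcd : DifferentiableAt ℝ c z := by
    have h1 : DifferentiableAt ℝ (fun y => (Q y).inverse) z :=
      ((hQinv.self_of_nhds.contDiffAt_map_inverse (n := 1)).differentiableAt (by simp)).comp z hQd
    exact h1.clm_apply (P.differentiableAt.comp z hu)
  have huc : u =ᶠ[𝓝 z] fun y => w y (c y) := by
    filter_upwards [hmem, hQinv] with y ⟨a, ha⟩ ⟨e, he⟩
    have : P (u y) = e a := by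
      rw [← ha]
      exact (congrArg (fun T : V →L[ℝ] V => T a) he).symm
    simp only [hc]
    rw [← he, ContinuousLinearMap.inverse_equiv, this]
    simpa using ha.symm
  rw [huc.fderiv_eq, huc.self_of_nhds, fderiv_clm_apply hw hcd]
  have h := hpar (c z)
  refine ⟨fderiv ℝ c z v, ?_⟩
  simp only [add_apply, ContinuousLinearMap.comp_apply,
    ContinuousLinearMap.flip_apply]
  rw [add_assoc, h, add_zero]
  rfl

end ParallelFrame

namespace Foliation

theorem tendsto_extChartAt_symm {n : ℕ} {M : Type*} [TopologicalSpace M]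
    [ChartedSpace (EuclideanSpace ℝ (Fin n)) M] (x₀ : M) :
    Filter.Tendsto (extChartAt (𝓡 n) x₀).symm (𝓝 (extChartAt (𝓡 n) x₀ x₀)) (𝓝 x₀) := by
  simpa [ContinuousAt] using continuousAt_extChartAt_symm (I := 𝓡 n) x₀

theorem mlieBracket_eq_lieBracket {E : Type*} [NormedAddCommGroup E] [NormedSpace ℝ E]
    (V W : (x : E) → TangentSpace 𝓘(ℝ, E) x) :
    VectorField.mlieBracket 𝓘(ℝ, E) V W = VectorField.lieBracket ℝ V W := by
  rw [← VectorField.mlieBracketWithin_univ, VectorField.mlieBracketWithin_eq_lieBracketWithin]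
  exact VectorField.lieBracketWithin_univ

/-! ### Vector fields in a chart. -/

section ChartFields

variable {n : ℕ} {M : Type*} [TopologicalSpace M] [ChartedSpace (EuclideanSpace ℝ (Fin n)) M]
  [IsManifold (𝓡 n) ∞ M]

/-- Coordinates of tangent vectors at `y` in the chart at `x₀`. -/
noncomputable def toChart (x₀ y : M) :
    TangentSpace (𝓡 n) y →L[ℝ] EuclideanSpace ℝ (Fin n) :=
  (trivializationAt (EuclideanSpace ℝ (Fin n)) (TangentSpace (𝓡 n)) x₀).continuousLinearMapAt ℝ y

/-- The tangent vector at `y` with given coordinates in the chart at `x₀`. -/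
noncomputable def ofChart (x₀ y : M) :
    EuclideanSpace ℝ (Fin n) →L[ℝ] TangentSpace (𝓡 n) y :=
  (trivializationAt (EuclideanSpace ℝ (Fin n)) (TangentSpace (𝓡 n)) x₀).symmL ℝ y

/-- The coordinate expression of a vector field in the chart at `x₀`. -/
noncomputable def chartRep (x₀ : M) (X : Field n M) :
    EuclideanSpace ℝ (Fin n) → EuclideanSpace ℝ (Fin n) :=
  fun z => toChart x₀ ((extChartAt (𝓡 n) x₀).symm z) (X ((extChartAt (𝓡 n) x₀).symm z))

/-- The vector field with a given coordinate expression in the chart at `x₀`. -/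
noncomputable def chartField (x₀ : M)
    (u : EuclideanSpace ℝ (Fin n) → EuclideanSpace ℝ (Fin n)) : Field n M :=
  fun y => ofChart x₀ y (u (extChartAt (𝓡 n) x₀ y))

theorem mdifferentiableAt_of_contMDiffAt {X : Field n M} {y : M}
    (hX : ContMDiffAt (𝓡 n) (𝓡 n).tangent ∞ (fun x => (⟨x, X x⟩ : TangentBundle (𝓡 n) M)) y) :
    MDifferentiableAt (𝓡 n) (𝓡 n).tangent (fun x => (⟨x, X x⟩ : TangentBundle (𝓡 n) M)) y :=
  hX.mdifferentiableAt (by simp)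

variable {x₀ y : M}

theorem toChart_ofChart (hy : y ∈ (extChartAt (𝓡 n) x₀).source) (u : EuclideanSpace ℝ (Fin n)) :
    toChart x₀ y (ofChart x₀ y u) = u :=
  Trivialization.continuousLinearMapAt_symmL _ (by simpa using hy) u

theorem ofChart_toChart (hy : y ∈ (extChartAt (𝓡 n) x₀).source) (v : TangentSpace (𝓡 n) y) :
    ofChart x₀ y (toChart x₀ y v) = v :=
  Trivialization.symmL_continuousLinearMapAt _ (by simpa using hy) v

theorem toChart_injective (hy : y ∈ (extChartAt (𝓡 n) x₀).source) :
    Function.Injective (toChart x₀ y : TangentSpace (𝓡 n) y → EuclideanSpace ℝ (Fin n)) :=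
  Function.LeftInverse.injective (ofChart_toChart hy)

theorem toChart_eq_mfderiv (hy : y ∈ (extChartAt (𝓡 n) x₀).source) :
    toChart x₀ y = mfderiv (𝓡 n) 𝓘(ℝ, EuclideanSpace ℝ (Fin n)) (extChartAt (𝓡 n) x₀) y :=
  TangentBundle.continuousLinearMapAt_trivializationAt (by simpa using hy)

theorem chartRep_apply (hy : y ∈ (extChartAt (𝓡 n) x₀).source) (X : Field n M) :
    chartRep x₀ X (extChartAt (𝓡 n) x₀ y) = toChart x₀ y (X y) := by
  simp only [chartRep]
  rw [(extChartAt (𝓡 n) x₀).left_inv hy]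

theorem chartRep_chartField {z : EuclideanSpace ℝ (Fin n)}
    (hz : z ∈ (extChartAt (𝓡 n) x₀).target)
    (u : EuclideanSpace ℝ (Fin n) → EuclideanSpace ℝ (Fin n)) :
    chartRep x₀ (chartField x₀ u) z = u z := by
  simp only [chartRep, chartField]
  rw [toChart_ofChart ((extChartAt (𝓡 n) x₀).map_target hz), (extChartAt (𝓡 n) x₀).right_inv hz]

theorem contMDiffAt_iff_chartRep (hy : y ∈ (extChartAt (𝓡 n) x₀).source) (X : Field n M) :
    ContMDiffAt (𝓡 n) (𝓡 n).tangent ∞ (fun x => (⟨x, X x⟩ : TangentBundle (𝓡 n) M)) y ↔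
      ContDiffAt ℝ ∞ (chartRep x₀ X) (extChartAt (𝓡 n) x₀ y) := by
  have hy' : y ∈ (trivializationAt (EuclideanSpace ℝ (Fin n))
      (TangentSpace (𝓡 n)) x₀).baseSet := by simpa using hy
  have h1 := Trivialization.contMDiffAt_section_iff (IB := 𝓡 n) (n := ∞) (s := X)
    (trivializationAt (EuclideanSpace ℝ (Fin n)) (TangentSpace (𝓡 n) : M → Type _) x₀) hy'
  refine h1.trans ?_
  have h2 : (fun x => ((trivializationAt (EuclideanSpace ℝ (Fin n))
      (TangentSpace (𝓡 n) : M → Type _) x₀) ⟨x, X x⟩).2) =ᶠ[𝓝 y] fun x => toChart x₀ x (X x) := by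
    filter_upwards [(trivializationAt (EuclideanSpace ℝ (Fin n))
      (TangentSpace (𝓡 n) : M → Type _) x₀).open_baseSet.mem_nhds hy'] with x hx
    simp only [toChart]
    rw [Trivialization.continuousLinearMapAt_apply, Trivialization.linearMapAt_apply, if_pos hx]
  rw [h2.contMDiffAt_iff, contMDiffAt_iff_source_of_mem_source (x := x₀) (by simpa using hy)]
  rw [← contMDiffAt_iff_contDiffAt]
  simp only [ModelWithCorners.range_eq_univ, contMDiffWithinAt_univ]
  rfl

theorem chartRep_chartField_eventuallyEq (hy : y ∈ (extChartAt (𝓡 n) x₀).source)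
    (u : EuclideanSpace ℝ (Fin n) → EuclideanSpace ℝ (Fin n)) :
    chartRep x₀ (chartField x₀ u) =ᶠ[𝓝 (extChartAt (𝓡 n) x₀ y)] u := by
  filter_upwards [(isOpen_extChartAt_target x₀).mem_nhds ((extChartAt (𝓡 n) x₀).map_source hy)]
    with z hz
  exact chartRep_chartField hz u

theorem contMDiffAt_chartField (hy : y ∈ (extChartAt (𝓡 n) x₀).source)
    {u : EuclideanSpace ℝ (Fin n) → EuclideanSpace ℝ (Fin n)}
    (hu : ContDiffAt ℝ ∞ u (extChartAt (𝓡 n) x₀ y)) :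
    ContMDiffAt (𝓡 n) (𝓡 n).tangent ∞
      (fun x => (⟨x, chartField x₀ u x⟩ : TangentBundle (𝓡 n) M)) y := by
  rw [contMDiffAt_iff_chartRep hy]
  exact hu.congr_of_eventuallyEq (chartRep_chartField_eventuallyEq hy u)

/-- These fields are pullbacks by the chart of constant fields, the bracket commutes with pullback,
and constant fields commute. -/
theorem mlieBracket_chartField_const (hy : y ∈ (extChartAt (𝓡 n) x₀).source)
    (v w : EuclideanSpace ℝ (Fin n)) :
    VectorField.mlieBracket (𝓡 n) (chartField x₀ fun _ => v) (chartField x₀ fun _ => w) y = 0 := by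
  have : IsManifold (𝓡 n) (minSmoothness ℝ 2) M := by
    rw [minSmoothness_of_isRCLikeNormedField]
    exact IsManifold.of_le (n := ∞) (by simpa using WithTop.coe_le_coe.2 (le_top : (2 : ℕ∞) ≤ ⊤))
  have hpull : ∀ u : EuclideanSpace ℝ (Fin n), chartField x₀ (fun _ => u) =ᶠ[𝓝 y]
      VectorField.mpullback (𝓡 n) 𝓘(ℝ, EuclideanSpace ℝ (Fin n)) (extChartAt (𝓡 n) x₀)
        (fun _ => u) := by
    intro u
    filter_upwards [(isOpen_extChartAt_source x₀).mem_nhds hy] with x hx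
    refine Eq.symm ((isInvertible_mfderiv_extChartAt hx).inverse_apply_eq.2 ?_)
    have h1 := toChart_ofChart hx u
    rw [toChart_eq_mfderiv hx] at h1
    exact h1.symm
  have hc : ∀ u : EuclideanSpace ℝ (Fin n), MDifferentiableAt 𝓘(ℝ, EuclideanSpace ℝ (Fin n))
      𝓘(ℝ, EuclideanSpace ℝ (Fin n)).tangent (fun x => (⟨x, u⟩ :
        TangentBundle 𝓘(ℝ, EuclideanSpace ℝ (Fin n)) (EuclideanSpace ℝ (Fin n))))
      (extChartAt (𝓡 n) x₀ y) := by
    intro u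
    exact mdifferentiableAt_of_contMDiffAt (n := n) (X := fun _ => u)
      ((contMDiffAt_iff_chartRep (x₀ := extChartAt (𝓡 n) x₀ y) (by simp) _).2
        (by
          have : chartRep (extChartAt (𝓡 n) x₀ y) (fun _ => u) = fun _ => u := by
            funext z; simp [chartRep, toChart]; rfl
          rw [this]; exact contDiffAt_const))
  rw [(hpull v).mlieBracket_vectorField_eq (hpull w),
    ← VectorField.mpullback_mlieBracket (n := ∞) (hc v) (hc w)
      (contMDiffAt_extChartAt' (by simpa using hy)) (by
        simpa using WithTop.coe_le_coe.2 (le_top : (2 : ℕ∞) ≤ ⊤))]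
  have h0 : VectorField.mlieBracket 𝓘(ℝ, EuclideanSpace ℝ (Fin n))
      (fun _ : EuclideanSpace ℝ (Fin n) => v) (fun _ => w) = 0 := by
    refine (mlieBracket_eq_lieBracket _ _).trans ?_
    funext z
    simp [VectorField.lieBracket]
    rfl
  rw [h0, VectorField.mpullback_zero]
  rfl

end ChartFields

/-! ### Christoffel symbols. -/

section Christoffel

variable {n : ℕ} {M : Type*} [TopologicalSpace M] [ChartedSpace (EuclideanSpace ℝ (Fin n)) M]
  [IsManifold (𝓡 n) ∞ M]

/-- Conjugation by chart coordinates is the trivialization of the endomorphism bundle. Applied to `∇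
X_j`, this gives smoothness of the Christoffel symbols. -/
theorem contDiffAt_chartRep_hom {x₀ y : M} (hy : y ∈ (extChartAt (𝓡 n) x₀).source)
    (A : (x : M) → TangentSpace (𝓡 n) x →L[ℝ] TangentSpace (𝓡 n) x)
    (hA : ContMDiffAt (𝓡 n)
      ((𝓡 n).prod 𝓘(ℝ, EuclideanSpace ℝ (Fin n) →L[ℝ] EuclideanSpace ℝ (Fin n))) ∞
      (fun x => TotalSpace.mk' (EuclideanSpace ℝ (Fin n) →L[ℝ] EuclideanSpace ℝ (Fin n))
        (E := fun x : M => TangentSpace (𝓡 n) x →L[ℝ] TangentSpace (𝓡 n) x) x (A x)) y) :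
    ContDiffAt ℝ ∞ (fun z => toChart x₀ ((extChartAt (𝓡 n) x₀).symm z) ∘L
      A ((extChartAt (𝓡 n) x₀).symm z) ∘L ofChart x₀ ((extChartAt (𝓡 n) x₀).symm z))
      (extChartAt (𝓡 n) x₀ y) := by
  have hy' : y ∈ (trivializationAt (EuclideanSpace ℝ (Fin n) →L[ℝ] EuclideanSpace ℝ (Fin n))
      (fun x : M => TangentSpace (𝓡 n) x →L[ℝ] TangentSpace (𝓡 n) x) x₀).baseSet := by
    rw [hom_trivializationAt_baseSet]
    simpa using hy
  have h1 := (Trivialization.contMDiffAt_section_iff (IB := 𝓡 n) (n := ∞) (s := A)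
    (trivializationAt (EuclideanSpace ℝ (Fin n) →L[ℝ] EuclideanSpace ℝ (Fin n))
      (fun x : M => TangentSpace (𝓡 n) x →L[ℝ] TangentSpace (𝓡 n) x) x₀) hy').1 hA
  rw [contMDiffAt_iff_source_of_mem_source (x := x₀) (by simpa using hy)] at h1
  rw [← contMDiffAt_iff_contDiffAt]
  simp only [ModelWithCorners.range_eq_univ, contMDiffWithinAt_univ] at h1
  exact h1

variable (nabla : Connection n M)

/-- The Leibniz rule for finite linear combinations of vector fields. -/
theorem connection_sum_smul {ι : Type*} (s : Finset ι) {κ : ι → M → ℝ} {X : ι → Field n M} {y : M}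
    (hκ : ∀ i ∈ s, MDifferentiableAt (𝓡 n) 𝓘(ℝ, ℝ) (κ i) y)
    (hX : ∀ i ∈ s, MDifferentiableAt (𝓡 n) (𝓡 n).tangent
      (fun x => (⟨x, X i x⟩ : TangentBundle (𝓡 n) M)) y) :
    nabla (∑ i ∈ s, κ i • X i) y =
      ∑ i ∈ s, (κ i y • nabla (X i) y + (mvfderiv (𝓡 n) (κ i) y).smulRight (X i y)) := by
  classical
  induction s using Finset.induction_on with
  | empty =>
    simp
  | insert i s hi ih =>
    have hsum : MDifferentiableAt (𝓡 n) (𝓡 n).tangent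
        (fun x => (⟨x, (∑ i ∈ s, κ i • X i) x⟩ : TangentBundle (𝓡 n) M)) y := by
      have h1 := MDifferentiableAt.sum_section (s := s) (t := fun i => κ i • X i) (I := 𝓡 n)
        (F := EuclideanSpace ℝ (Fin n)) (x₀ := y)
        (fun i hi => (hκ i (by simp [hi])).smul_section (hX i (by simp [hi])))
      simpa [Finset.sum_apply] using h1
    rw [Finset.sum_insert hi, Finset.sum_insert hi,
      nabla.isCovariantDerivativeOnUniv.add
        ((hκ i (by simp)).smul_section (hX i (by simp))) hsum,
      nabla.isCovariantDerivativeOnUniv.leibniz (hX i (by simp)) (hκ i (by simp)),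
      ih (fun i hi => hκ i (by simp [hi])) (fun i hi => hX i (by simp [hi]))]

/-- In a chart, a smooth connection is given by smooth Christoffel symbols. -/
theorem exists_christoffel [T2Space M]
    (hsm : CovariantDerivative.ContMDiffCovariantDerivative nabla ∞) (x₀ : M) :
    ∃ Γ : EuclideanSpace ℝ (Fin n) →
        EuclideanSpace ℝ (Fin n) →L[ℝ] EuclideanSpace ℝ (Fin n) →L[ℝ] EuclideanSpace ℝ (Fin n),
      ContDiff ℝ ∞ Γ ∧ ∀ᶠ y in 𝓝 x₀, ∀ X : Field n M,
        ContMDiffAt (𝓡 n) (𝓡 n).tangent ∞ (fun x => (⟨x, X x⟩ : TangentBundle (𝓡 n) M)) y →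
        ∀ v : TangentSpace (𝓡 n) y, toChart x₀ y (nabla X y v) =
          fderiv ℝ (chartRep x₀ X) (extChartAt (𝓡 n) x₀ y) (toChart x₀ y v) +
            Γ (extChartAt (𝓡 n) x₀ y) (toChart x₀ y v)
              (chartRep x₀ X (extChartAt (𝓡 n) x₀ y)) := by
  obtain ⟨ψ⟩ : Nonempty (SmoothBumpFunction (𝓡 n) x₀) := inferInstance
  set φ := extChartAt (𝓡 n) x₀ with hφ
  set e : Fin n → EuclideanSpace ℝ (Fin n) := fun j => EuclideanSpace.single j 1 with he
  -- Smoothness of the connection is tested on global smooth sections, so the coordinate fields are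
  -- cut off by a bump function equal to `1` near `x₀`.
  set X : Fin n → Field n M := fun j => (ψ : M → ℝ) • chartField x₀ (fun _ => e j) with hX
  have hXs : ∀ j, ContMDiff (𝓡 n) (𝓡 n).tangent ∞
      (fun x => (⟨x, X j x⟩ : TangentBundle (𝓡 n) M)) := by
    intro j
    refine ContMDiffOn.smul_section_of_tsupport (u := φ.source) ψ.contMDiff.contMDiffOn
      (isOpen_extChartAt_source x₀) ψ.tsupport_subset_extChartAt_source ?_
    exact fun y hy => (contMDiffAt_chartField hy contDiffAt_const).contMDiffWithinAt
  have hnabla : ∀ j (y : M), ContMDiffAt (𝓡 n)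
      ((𝓡 n).prod 𝓘(ℝ, EuclideanSpace ℝ (Fin n) →L[ℝ] EuclideanSpace ℝ (Fin n))) ∞
      (fun x => TotalSpace.mk' (EuclideanSpace ℝ (Fin n) →L[ℝ] EuclideanSpace ℝ (Fin n))
        (E := fun x : M => TangentSpace (𝓡 n) x →L[ℝ] TangentSpace (𝓡 n) x) x (nabla (X j) x)) y :=
    fun j y => (hsm.contMDiff.contMDiff (hXs j).contMDiffOn).contMDiffAt Filter.univ_mem
  set G : Fin n → EuclideanSpace ℝ (Fin n) → EuclideanSpace ℝ (Fin n) →L[ℝ]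
      EuclideanSpace ℝ (Fin n) := fun j z => toChart x₀ (φ.symm z) ∘L
        nabla (X j) (φ.symm z) ∘L ofChart x₀ (φ.symm z) with hG
  set Γ₀ : EuclideanSpace ℝ (Fin n) →
        EuclideanSpace ℝ (Fin n) →L[ℝ] EuclideanSpace ℝ (Fin n) →L[ℝ] EuclideanSpace ℝ (Fin n) :=
    fun z => ∑ j, (ContinuousLinearMap.smulRightL ℝ (EuclideanSpace ℝ (Fin n))
      (EuclideanSpace ℝ (Fin n)) (EuclideanSpace.proj j)) ∘L G j z with hΓ₀
  have hΓ₀s : ContDiffOn ℝ ∞ Γ₀ φ.target := by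
    intro z hz
    refine ContDiffAt.contDiffWithinAt (ContDiffAt.sum fun j _ => contDiffAt_const.clm_comp ?_)
    have h1 := contDiffAt_chartRep_hom (φ.map_target hz) (nabla (X j)) (hnabla j _)
    rw [← hφ, φ.right_inv hz] at h1
    exact h1
  -- `Γ₀` is smooth only on the chart's target; the ODE results need a form smooth on the whole
  -- space, and only its germ matters.
  obtain ⟨Γ, hΓ, hΓeq⟩ := hΓ₀s.exists_contDiff_eventuallyEq (isOpen_extChartAt_target x₀)
    (mem_extChartAt_target x₀)
  refine ⟨Γ, hΓ, ?_⟩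
  filter_upwards [(isOpen_extChartAt_source x₀).mem_nhds (mem_extChartAt_source (I := 𝓡 n) x₀),
    ψ.eventuallyEq_one.eventually_nhds,
    (continuousAt_extChartAt (I := 𝓡 n) x₀).eventually hΓeq] with y hy hψ hΓy Y hY v
  rw [hΓy]
  set κ : Fin n → M → ℝ := fun j x => chartRep x₀ Y (φ x) j with hκ
  have hYd : HasFDerivAt (chartRep x₀ Y) (fderiv ℝ (chartRep x₀ Y) (φ y)) (φ y) :=
    (((contMDiffAt_iff_chartRep hy Y).1 hY).differentiableAt (by simp)).hasFDerivAt
  have hφd : MDifferentiableAt (𝓡 n) 𝓘(ℝ, EuclideanSpace ℝ (Fin n)) φ y :=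
    mdifferentiableAt_extChartAt (by simpa [hφ] using hy)
  have hd : ∀ j, DifferentiableAt ℝ (fun z => chartRep x₀ Y z j) (φ y) := fun j =>
    (EuclideanSpace.proj (𝕜 := ℝ) j).differentiableAt.comp _ hYd.differentiableAt
  have hκd : ∀ j, MDifferentiableAt (𝓡 n) 𝓘(ℝ, ℝ) (κ j) y := fun j =>
    (hd j).mdifferentiableAt.comp y hφd
  have hκv : ∀ j, mvfderiv (𝓡 n) (κ j) y v =
      fderiv ℝ (chartRep x₀ Y) (φ y) (toChart x₀ y v) j := by
    intro j
    rw [toChart_eq_mfderiv hy]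
    have h1 := mvfderiv_comp_apply y (hd j).mdifferentiableAt hφd v
    refine h1.trans ?_
    have h2 : HasFDerivAt (fun z => chartRep x₀ Y z j)
        ((EuclideanSpace.proj (𝕜 := ℝ) j) ∘L fderiv ℝ (chartRep x₀ Y) (φ y)) (φ y) :=
      (EuclideanSpace.proj (𝕜 := ℝ) j).hasFDerivAt.comp _ hYd
    simp only [mvfderiv, mfderiv_eq_fderiv]
    rw [h2.fderiv]
    rfl
  have hexp : ∀ u : EuclideanSpace ℝ (Fin n), ∑ j, u j • e j = u := by
    intro u
    ext i
    simp [he, Finset.sum_apply, Pi.single_apply]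
  -- Where the bump function is `1`, the fields `X j` are a frame. In the Leibniz rule the
  -- derivatives of the coefficients give `dY`, and the terms `∇ X_j` give `Γ`.
  have hYX : ∀ᶠ x in 𝓝 y, Y x = (∑ j, κ j • X j) x := by
    filter_upwards [hψ, (isOpen_extChartAt_source x₀).mem_nhds hy] with x hx hxs
    apply toChart_injective hxs
    have h1 : ∀ j, (κ j • X j) x = κ j x • ofChart x₀ x (e j) := by
      intro j
      change κ j x • (ψ x • ofChart x₀ x (e j)) = _
      rw [hx]
      simp
    rw [Finset.sum_apply, Finset.sum_congr rfl (fun j _ => h1 j), map_sum]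
    simp only [map_smul, toChart_ofChart hxs]
    rw [hκ, hexp, chartRep_apply hxs]
  have hXd := fun j => mdifferentiableAt_of_contMDiffAt ((hXs j).contMDiffAt (x := y))
  have hsumd : MDifferentiableAt (𝓡 n) (𝓡 n).tangent
      (fun x => (⟨x, (∑ j, κ j • X j) x⟩ : TangentBundle (𝓡 n) M)) y := by
    have h1 := MDifferentiableAt.sum_section (s := Finset.univ) (t := fun i => κ i • X i) (I := 𝓡 n)
        (F := EuclideanSpace ℝ (Fin n)) (x₀ := y)
        (fun i _ => (hκd i).smul_section (hXd i))
    simpa [Finset.sum_apply] using h1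
  rw [nabla.isCovariantDerivativeOnUniv.congr_of_eventuallyEq
    (mdifferentiableAt_of_contMDiffAt hY) hsumd Filter.univ_mem hYX,
    connection_sum_smul nabla _ (fun j _ => hκd j) (fun j _ => hXd j)]
  have hXy : ∀ j, X j y = ofChart x₀ y (e j) := by
    intro j
    change ψ y • ofChart x₀ y (e j) = _
    rw [hψ.self_of_nhds]
    simp
  have hsplit : toChart x₀ y ((∑ j, (κ j y • nabla (X j) y
      + (mvfderiv (𝓡 n) (κ j) y).smulRight (X j y))) v) =
      ∑ j, κ j y • toChart x₀ y (nabla (X j) y v) +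
        ∑ j, mvfderiv (𝓡 n) (κ j) y v • e j := by
    rw [← Finset.sum_add_distrib, sum_apply, map_sum]
    refine Finset.sum_congr rfl fun j _ => ?_
    simp [hXy, toChart_ofChart hy]
  rw [hsplit, add_comm]
  congr 1
  · simp only [hκv]
    exact hexp _
  · rw [hΓ₀]
    simp only [sum_apply]
    refine Finset.sum_congr rfl fun j _ => ?_
    have hinv : φ.symm (φ y) = y := φ.left_inv hy
    simp only [hG, ContinuousLinearMap.comp_apply]
    rw [hinv, ofChart_toChart hy]
    rfl

end Christoffel

theorem fderiv_apply_apply_const {E F G H : Type*} [NormedAddCommGroup E] [NormedSpace ℝ E]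
    [NormedAddCommGroup F] [NormedSpace ℝ F] [NormedAddCommGroup G] [NormedSpace ℝ G]
    [NormedAddCommGroup H] [NormedSpace ℝ H] {Γ : E → F →L[ℝ] G →L[ℝ] H} {z : E}
    (hΓ : DifferentiableAt ℝ Γ z) (b : F) (e : G) (a : E) :
    fderiv ℝ (fun y => Γ y b e) z a = fderiv ℝ Γ z a b e := by
  have h : HasFDerivAt (fun y => Γ y b e) _ z :=
    (hΓ.hasFDerivAt.clm_apply (hasFDerivAt_const b z)).clm_apply (hasFDerivAt_const e z)
  rw [h.fderiv]
  simp

/-! ### The connection and its curvature in coordinates. -/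

section Coordinates

variable {n : ℕ} {M : Type*} [TopologicalSpace M] [ChartedSpace (EuclideanSpace ℝ (Fin n)) M]
  [IsManifold (𝓡 n) ∞ M]

theorem contDiffAt_chartRep {x₀ : M} {X : Field n M} {U : Set M} (hU : IsOpen U)
    (hX : SmoothFieldOn X U) {z : EuclideanSpace ℝ (Fin n)}
    (hz : z ∈ (extChartAt (𝓡 n) x₀).target) (hzU : (extChartAt (𝓡 n) x₀).symm z ∈ U) :
    ContDiffAt ℝ ∞ (chartRep x₀ X) z := by
  have h := (contMDiffAt_iff_chartRep ((extChartAt (𝓡 n) x₀).map_target hz) X).1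
    (ContMDiffOn.contMDiffAt hX (hU.mem_nhds hzU))
  rwa [(extChartAt (𝓡 n) x₀).right_inv hz] at h

theorem chartRep_chartField_eventuallyEq' {x₀ : M} {z : EuclideanSpace ℝ (Fin n)}
    (hz : z ∈ (extChartAt (𝓡 n) x₀).target)
    (u : EuclideanSpace ℝ (Fin n) → EuclideanSpace ℝ (Fin n)) :
    chartRep x₀ (chartField x₀ u) =ᶠ[𝓝 z] u := by
  filter_upwards [(isOpen_extChartAt_target x₀).mem_nhds hz] with y hy
  exact chartRep_chartField hy u

theorem smoothFieldOn_chartField {x₀ : M} {U : Set M} (hU : U ⊆ (extChartAt (𝓡 n) x₀).source)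
    {u : EuclideanSpace ℝ (Fin n) → EuclideanSpace ℝ (Fin n)}
    (hu : ∀ y ∈ U, ContDiffAt ℝ ∞ u (extChartAt (𝓡 n) x₀ y)) :
    SmoothFieldOn (chartField x₀ u) U :=
  fun y hy => (contMDiffAt_chartField (hU hy) (hu y hy)).contMDiffWithinAt

variable (nabla : Connection n M)

/-- In the chart at `x₀`, the connection `nabla` has Christoffel symbols `Γ` at the point with
coordinates `z`. -/
structure HasChristoffelAt (x₀ : M)
    (Γ : EuclideanSpace ℝ (Fin n) →L[ℝ] EuclideanSpace ℝ (Fin n) →L[ℝ] EuclideanSpace ℝ (Fin n))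
    (z : EuclideanSpace ℝ (Fin n)) : Prop where
  mem_target : z ∈ (extChartAt (𝓡 n) x₀).target
  toChart_nabla (X : Field n M) (hX : ContDiffAt ℝ ∞ (chartRep x₀ X) z)
    (v : TangentSpace (𝓡 n) ((extChartAt (𝓡 n) x₀).symm z)) :
    toChart x₀ ((extChartAt (𝓡 n) x₀).symm z) (nabla X ((extChartAt (𝓡 n) x₀).symm z) v) =
      fderiv ℝ (chartRep x₀ X) z (toChart x₀ ((extChartAt (𝓡 n) x₀).symm z) v) +
        Γ (toChart x₀ ((extChartAt (𝓡 n) x₀).symm z) v) (chartRep x₀ X z)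

theorem exists_hasChristoffelAt [T2Space M]
    (hsm : CovariantDerivative.ContMDiffCovariantDerivative nabla ∞) (x₀ : M) :
    ∃ Γ : EuclideanSpace ℝ (Fin n) →
        EuclideanSpace ℝ (Fin n) →L[ℝ] EuclideanSpace ℝ (Fin n) →L[ℝ] EuclideanSpace ℝ (Fin n),
      ContDiff ℝ ∞ Γ ∧
        ∀ᶠ z in 𝓝 (extChartAt (𝓡 n) x₀ x₀), HasChristoffelAt nabla x₀ (Γ z) z := by
  obtain ⟨Γ, hΓ, h⟩ := exists_christoffel nabla hsm x₀
  refine ⟨Γ, hΓ, ?_⟩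
  filter_upwards [(tendsto_extChartAt_symm x₀).eventually h, extChartAt_target_mem_nhds x₀]
    with z hz hzt
  refine ⟨hzt, fun X hX v => ?_⟩
  have h1 := hz X ((contMDiffAt_iff_chartRep ((extChartAt (𝓡 n) x₀).map_target hzt) X).2 (by
    rwa [(extChartAt (𝓡 n) x₀).right_inv hzt])) v
  rwa [(extChartAt (𝓡 n) x₀).right_inv hzt] at h1

variable {nabla} {x₀ : M}

theorem HasChristoffelAt.chartRep_covDeriv
    {Γ : EuclideanSpace ℝ (Fin n) →L[ℝ] EuclideanSpace ℝ (Fin n) →L[ℝ] EuclideanSpace ℝ (Fin n)}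
    {z : EuclideanSpace ℝ (Fin n)} (h : HasChristoffelAt nabla x₀ Γ z) (Y : Field n M)
    {X : Field n M} (hX : ContDiffAt ℝ ∞ (chartRep x₀ X) z) :
    chartRep x₀ (covDeriv nabla Y X) z =
      fderiv ℝ (chartRep x₀ X) z (chartRep x₀ Y z) + Γ (chartRep x₀ Y z) (chartRep x₀ X z) :=
  h.toChart_nabla X hX _

/-- The coordinate expression of the vanishing of the curvature. -/
theorem IsFlat.christoffel (hflat : IsFlat nabla)
    {Γ : EuclideanSpace ℝ (Fin n) →
      EuclideanSpace ℝ (Fin n) →L[ℝ] EuclideanSpace ℝ (Fin n) →L[ℝ] EuclideanSpace ℝ (Fin n)}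
    (hΓ : ContDiff ℝ ∞ Γ) {z : EuclideanSpace ℝ (Fin n)}
    (h : ∀ᶠ y in 𝓝 z, HasChristoffelAt nabla x₀ (Γ y) y) (v w : EuclideanSpace ℝ (Fin n)) :
    fderiv ℝ Γ z v w - fderiv ℝ Γ z w v + Γ z v * Γ z w - Γ z w * Γ z v = 0 := by
  have hzt := h.self_of_nhds.mem_target
  set K : EuclideanSpace ℝ (Fin n) → Field n M := fun u => chartField x₀ fun _ => u with hK
  have hKe : ∀ u, chartRep x₀ (K u) =ᶠ[𝓝 z] fun _ => u := fun u =>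
    chartRep_chartField_eventuallyEq' hzt _
  have hKs : ∀ u, SmoothFieldOn (K u) (extChartAt (𝓡 n) x₀).source := fun u =>
    smoothFieldOn_chartField subset_rfl fun _ _ => contDiffAt_const
  ext e : 1
  have hD : ∀ a, chartRep x₀ (covDeriv nabla (K a) (K e)) =ᶠ[𝓝 z] fun y => Γ y a e := by
    intro a
    filter_upwards [h, (hKe e).eventually_nhds, hKe a] with y hy hey ha
    have he : chartRep x₀ (K e) =ᶠ[𝓝 y] fun _ => e := hey
    rw [hy.chartRep_covDeriv _ (contDiffAt_const.congr_of_eventuallyEq he), he.fderiv_eq, ha,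
      he.self_of_nhds]
    simp
  have hDs : ∀ a, ContDiffAt ℝ ∞ (fun y => Γ y a e) z := fun a =>
    (hΓ.contDiffAt.clm_apply contDiffAt_const).clm_apply contDiffAt_const
  have hDD : ∀ a b, chartRep x₀ (covDeriv nabla (K a) (covDeriv nabla (K b) (K e))) z =
      fderiv ℝ Γ z a b e + Γ z a (Γ z b e) := by
    intro a b
    rw [h.self_of_nhds.chartRep_covDeriv _ ((hDs b).congr_of_eventuallyEq (hD b)),
      (hD b).fderiv_eq, (hKe a).self_of_nhds, (hD b).self_of_nhds]
    rw [fderiv_apply_apply_const (hΓ.differentiable (by simp) z)]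
  set y := (extChartAt (𝓡 n) x₀).symm z with hy
  have hys : y ∈ (extChartAt (𝓡 n) x₀).source := (extChartAt (𝓡 n) x₀).map_target hzt
  have hc := hflat _ (isOpen_extChartAt_source x₀) (K e) (K v) (K w) (hKs e) (hKs v) (hKs w) y hys
  -- With constant coordinate fields the bracket term drops out, leaving a commutator of second
  -- covariant derivatives.
  have hbr : covDeriv nabla (VectorField.mlieBracket (𝓡 n) (K v) (K w)) (K e) y = 0 := by
    simp only [covDeriv, hK]
    rw [mlieBracket_chartField_const hys, map_zero]
  have hc' : covDeriv nabla (K v) (covDeriv nabla (K w) (K e)) y -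
      covDeriv nabla (K w) (covDeriv nabla (K v) (K e)) y = 0 := by
    have : covDeriv nabla (K v) (covDeriv nabla (K w) (K e)) y -
      covDeriv nabla (K w) (covDeriv nabla (K v) (K e)) y -
      covDeriv nabla (VectorField.mlieBracket (𝓡 n) (K v) (K w)) (K e) y = 0 := hc
    rwa [hbr, sub_zero] at this
  have h3 := congrArg (toChart x₀ y) hc'
  rw [map_sub, map_zero] at h3
  have h4 := hDD v w
  have h5 := hDD w v
  simp only [chartRep] at h4 h5
  rw [h4, h5] at h3
  simp only [sub_apply, add_apply, mul_apply_eq_comp, zero_apply]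
  rw [← h3]
  abel

end Coordinates

/-! ### Existence of gauges. -/

section Gauge

variable {n : ℕ} {M : Type*} [TopologicalSpace M] [ChartedSpace (EuclideanSpace ℝ (Fin n)) M]
  [IsManifold (𝓡 n) ∞ M]

/-- The coordinates of the vectors of `D` at the point with coordinates `z` in the chart
at `x₀`. -/
noncomputable def chartDirections (x₀ : M) (D : SubspaceField n M) (z : EuclideanSpace ℝ (Fin n)) :
    Submodule ℝ (EuclideanSpace ℝ (Fin n)) :=
  (D ((extChartAt (𝓡 n) x₀).symm z)).map (toChart x₀ ((extChartAt (𝓡 n) x₀).symm z)).toLinearMap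

/-- There is an invertible matrix near `x₀` that is parallel in the directions of `D` with respect
to the Christoffel symbols `Γ`. -/
def HasGauge (x₀ : M) (D : SubspaceField n M)
    (Γ : EuclideanSpace ℝ (Fin n) →
      EuclideanSpace ℝ (Fin n) →L[ℝ] EuclideanSpace ℝ (Fin n) →L[ℝ] EuclideanSpace ℝ (Fin n)) :
    Prop :=
  ∃ B : EuclideanSpace ℝ (Fin n) → EuclideanSpace ℝ (Fin n) →L[ℝ] EuclideanSpace ℝ (Fin n),
    B (extChartAt (𝓡 n) x₀ x₀) = .id ℝ _ ∧
      ∀ᶠ z in 𝓝 (extChartAt (𝓡 n) x₀ x₀), ContDiffAt ℝ ∞ B z ∧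
        ∀ v ∈ chartDirections x₀ D z, fderiv ℝ B z v = -(Γ z v ∘L B z)

variable {nabla : Connection n M} {x₀ : M} {D : SubspaceField n M}
  {Γ : EuclideanSpace ℝ (Fin n) →
      EuclideanSpace ℝ (Fin n) →L[ℝ] EuclideanSpace ℝ (Fin n) →L[ℝ] EuclideanSpace ℝ (Fin n)}

theorem IsFlat.hasGauge (hflat : IsFlat nabla) (hΓ : ContDiff ℝ ∞ Γ)
    (h : ∀ᶠ z in 𝓝 (extChartAt (𝓡 n) x₀ x₀), HasChristoffelAt nabla x₀ (Γ z) z) :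
    HasGauge x₀ D Γ := by
  obtain ⟨B, hB₀, hB⟩ := exists_parallel_of_flat hΓ (extChartAt (𝓡 n) x₀ x₀)
    (h.eventually_nhds.mono fun z hz v w => hflat.christoffel hΓ hz v w)
  exact ⟨B, hB₀, hB.mono fun z hz => ⟨hz.1, fun v _ => hz.2 v⟩⟩

/-- A line field is generated near `x₀` by one field `Y`, nonzero at `x₀`. Transport along `Y`
suffices, since both sides of the gauge equation are linear in the direction. -/
theorem IsDistribution.hasGauge (hD : IsDistribution 1 D) (hΓ : ContDiff ℝ ∞ Γ) :
    HasGauge x₀ D Γ := by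
  obtain ⟨U, hxU, X, hX⟩ := hD x₀
  set φ := extChartAt (𝓡 n) x₀ with hφ
  have hsymm := tendsto_extChartAt_symm (n := n) x₀
  have ht : ∀ᶠ z in 𝓝 (φ x₀), z ∈ φ.target := extChartAt_target_mem_nhds x₀
  have hU : ∀ᶠ z in 𝓝 (φ x₀), φ.symm z ∈ U := hsymm.eventually (hX.isOpen.mem_nhds hxU)
  obtain ⟨W, hW, hWo, hxW⟩ := eventually_nhds_iff.1 (ht.and hU)
  obtain ⟨Y, hY, hYe⟩ := ContDiffOn.exists_contDiff_eventuallyEq (f := chartRep x₀ (X 0)) (U := W)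
    (fun z hz => (contDiffAt_chartRep hX.isOpen (hX.smooth 0) (hW z hz).1
      (hW z hz).2).contDiffWithinAt) hWo hxW
  have hY₀ : Y (φ x₀) ≠ 0 := by
    rw [hYe.self_of_nhds, hφ, chartRep_apply (mem_extChartAt_source x₀)]
    intro h0
    exact (hX.linearIndependent x₀ hxU).ne_zero 0
      (toChart_injective (mem_extChartAt_source x₀) (h0.trans (map_zero _).symm))
  obtain ⟨B, hB₀, hB⟩ := exists_transport_along_field (A := fun z => Γ z (Y z)) hY
    (hΓ.clm_apply hY) (φ x₀) hY₀
  refine ⟨B, hB₀, ?_⟩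
  filter_upwards [hB, hU, hYe] with z hz hzU hzY
  refine ⟨hz.1, ?_⟩
  rintro _ ⟨m, hm, rfl⟩
  have hm' : m ∈ Submodule.span ℝ (Set.range fun i => X i (φ.symm z)) := by
    rw [hX.span _ hzU]; exact hm
  rw [Set.range_unique, Submodule.mem_span_singleton] at hm'
  obtain ⟨c, rfl⟩ := hm'
  have h1 : toChart x₀ (φ.symm z) (c • X default (φ.symm z)) = c • Y z := by
    rw [map_smul, hzY]
    rfl
  have h2 : ∀ u, u = c • Y z → fderiv ℝ B z u = -(Γ z u ∘L B z) := by
    rintro _ rfl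
    rw [map_smul, hz.2, map_smul]
    ext; simp
  exact h2 _ h1

end Gauge

theorem isOpen_source_inter_preimage {n : ℕ} {M : Type*} [TopologicalSpace M]
    [ChartedSpace (EuclideanSpace ℝ (Fin n)) M] (x₀ : M) {W : Set (EuclideanSpace ℝ (Fin n))}
    (hW : IsOpen W) :
    IsOpen ((extChartAt (𝓡 n) x₀).source ∩ extChartAt (𝓡 n) x₀ ⁻¹' W) :=
  (continuousOn_extChartAt x₀).isOpen_inter_preimage (isOpen_extChartAt_source x₀) hW

/-! ### Local frames in coordinates. -/

section Frames

variable {n : ℕ} {M : Type*} [TopologicalSpace M] [ChartedSpace (EuclideanSpace ℝ (Fin n)) M]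
  [IsManifold (𝓡 n) ∞ M] {x₀ : M} {D : SubspaceField n M} {p : ℕ}

theorem chartRep_mem_chartDirections {z : EuclideanSpace ℝ (Fin n)}
    (hz : z ∈ (extChartAt (𝓡 n) x₀).target) (X : Field n M) :
    chartRep x₀ X z ∈ chartDirections x₀ D z ↔
      X ((extChartAt (𝓡 n) x₀).symm z) ∈ D ((extChartAt (𝓡 n) x₀).symm z) := by
  constructor
  · rintro ⟨m, hm, h⟩
    have h1 := toChart_injective ((extChartAt (𝓡 n) x₀).map_target hz) h
    rwa [← h1]
  · exact fun h => ⟨_, h, rfl⟩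

/-- The coordinate expression of a family of vector fields, as a family of linear maps. -/
noncomputable def frameRep (x₀ : M) (X : Fin p → Field n M) (z : EuclideanSpace ℝ (Fin n)) :
    (Fin p → ℝ) →L[ℝ] EuclideanSpace ℝ (Fin n) :=
  ∑ k, (ContinuousLinearMap.proj k : (Fin p → ℝ) →L[ℝ] ℝ).smulRight (chartRep x₀ (X k) z)

theorem frameRep_apply (X : Fin p → Field n M) (z : EuclideanSpace ℝ (Fin n)) (a : Fin p → ℝ) :
    frameRep x₀ X z a = ∑ k, a k • chartRep x₀ (X k) z := by
  simp [frameRep]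

theorem contDiffAt_frameRep {X : Fin p → Field n M} {z : EuclideanSpace ℝ (Fin n)}
    (hX : ∀ k, ContDiffAt ℝ ∞ (chartRep x₀ (X k)) z) : ContDiffAt ℝ ∞ (frameRep x₀ X) z :=
  ContDiffAt.sum fun k _ => contDiffAt_const.smulRight (hX k)

theorem fderiv_frameRep_apply {X : Fin p → Field n M} {z : EuclideanSpace ℝ (Fin n)}
    (hX : ∀ k, ContDiffAt ℝ ∞ (chartRep x₀ (X k)) z) (v : EuclideanSpace ℝ (Fin n))
    (a : Fin p → ℝ) :
    fderiv ℝ (frameRep x₀ X) z v a = ∑ k, a k • fderiv ℝ (chartRep x₀ (X k)) z v := by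
  have h1 : HasFDerivAt (fun y => frameRep x₀ X y a) _ z :=
    (((contDiffAt_frameRep hX).differentiableAt (by simp)).hasFDerivAt).clm_apply
      (hasFDerivAt_const a z)
  have h2 : HasFDerivAt (fun y => frameRep x₀ X y a)
      (∑ k, a k • fderiv ℝ (chartRep x₀ (X k)) z) z := by
    simp only [frameRep_apply]
    exact HasFDerivAt.fun_sum fun k _ =>
      (((hX k).differentiableAt (by simp)).hasFDerivAt).const_smul (a k)
  have h3 := congrArg (fun T => T v) (h1.unique h2)
  simpa using h3

theorem IsLocalBasis.frameRep_injective {U : Set M} {X : Fin p → Field n M}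
    (hX : IsLocalBasis D U X) {z : EuclideanSpace ℝ (Fin n)}
    (hz : z ∈ (extChartAt (𝓡 n) x₀).target) (hzU : (extChartAt (𝓡 n) x₀).symm z ∈ U) :
    Function.Injective (frameRep x₀ X z) := by
  rw [injective_iff_map_eq_zero]
  intro a ha
  rw [frameRep_apply] at ha
  have h1 : toChart x₀ ((extChartAt (𝓡 n) x₀).symm z)
      (∑ k, a k • X k ((extChartAt (𝓡 n) x₀).symm z)) = 0 := by
    rw [map_sum, ← ha]
    exact Finset.sum_congr rfl fun k _ => map_smul _ _ _
  have h2 := toChart_injective ((extChartAt (𝓡 n) x₀).map_target hz) (h1.trans (map_zero _).symm)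
  funext k
  exact Fintype.linearIndependent_iff.1 (hX.linearIndependent _ hzU) a h2 k

theorem IsLocalBasis.range_frameRep {U : Set M} {X : Fin p → Field n M}
    (hX : IsLocalBasis D U X) {z : EuclideanSpace ℝ (Fin n)}
    (hzU : (extChartAt (𝓡 n) x₀).symm z ∈ U) :
    (frameRep x₀ X z).range = chartDirections x₀ D z := by
  rw [chartDirections, ← hX.span _ hzU, Submodule.map_span, ← Set.range_comp]
  ext u
  rw [Submodule.mem_span_range_iff_exists_fun]
  exact exists_congr fun a => Eq.congr_left (frameRep_apply X z a)

theorem IsLocalBasis.contDiffAt_frameRep {U : Set M} {X : Fin p → Field n M}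
    (hX : IsLocalBasis D U X) {z : EuclideanSpace ℝ (Fin n)}
    (hz : z ∈ (extChartAt (𝓡 n) x₀).target) (hzU : (extChartAt (𝓡 n) x₀).symm z ∈ U) :
    ContDiffAt ℝ ∞ (frameRep x₀ X) z :=
  Foliation.contDiffAt_frameRep fun k => contDiffAt_chartRep hX.isOpen (hX.smooth k) hz hzU

theorem toChart_comp_chartField {y : M} (hy : y ∈ (extChartAt (𝓡 n) x₀).source)
    (w : EuclideanSpace ℝ (Fin n) → (Fin p → ℝ) →L[ℝ] EuclideanSpace ℝ (Fin n)) :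
    ((toChart x₀ y).toLinearMap ∘ fun k : Fin p =>
        chartField x₀ (fun z => w z (Pi.single k 1)) y) =
      (w (extChartAt (𝓡 n) x₀ y)).toLinearMap ∘ Pi.basisFun ℝ (Fin p) := by
  funext k
  rw [Function.comp_apply, Function.comp_apply, Pi.basisFun_apply]
  exact toChart_ofChart hy _

/-- A local basis of a distribution may be given in coordinates. -/
theorem isLocalBasis_chartField {W : Set (EuclideanSpace ℝ (Fin n))} (hW : IsOpen W)
    {w : EuclideanSpace ℝ (Fin n) → (Fin p → ℝ) →L[ℝ] EuclideanSpace ℝ (Fin n)}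
    (hw : ∀ z ∈ W, ContDiffAt ℝ ∞ w z ∧ Function.Injective (w z) ∧
      (w z).range = chartDirections x₀ D z) :
    IsLocalBasis D ((extChartAt (𝓡 n) x₀).source ∩ extChartAt (𝓡 n) x₀ ⁻¹' W)
      (fun k => chartField x₀ fun z => w z (Pi.single k 1)) where
  isOpen := isOpen_source_inter_preimage x₀ hW
  smooth k := smoothFieldOn_chartField Set.inter_subset_left fun y hy =>
    (hw _ hy.2).1.clm_apply contDiffAt_const
  linearIndependent y hy := by
    refine LinearIndependent.of_comp (toChart x₀ y).toLinearMap ?_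
    rw [toChart_comp_chartField hy.1]
    exact (Pi.basisFun ℝ (Fin p)).linearIndependent.map' _
      (LinearMap.ker_eq_bot.2 (hw _ hy.2).2.1)
  span y hy := by
    refine Submodule.map_injective_of_injective
      (f := (toChart x₀ y).toLinearMap) (toChart_injective hy.1) ?_
    have h2 := (hw _ hy.2).2.2
    rw [chartDirections, (extChartAt (𝓡 n) x₀).left_inv hy.1] at h2
    rw [Submodule.map_span, ← Set.range_comp,
      toChart_comp_chartField hy.1, ← h2, Set.range_comp, ← Submodule.map_span,
      (Pi.basisFun ℝ (Fin p)).span_eq, Submodule.map_top]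

/-- A vector of a distribution extends to a local vector field of the distribution. -/
theorem IsDistribution.exists_isFieldOf (hD : IsDistribution p D) {y : M}
    {m : TangentSpace (𝓡 n) y} (hm : m ∈ D y) :
    ∃ (V : Set M) (Y : Field n M), y ∈ V ∧ IsFieldOf D V Y ∧ Y y = m := by
  obtain ⟨V, hyV, X, hX⟩ := hD y
  rw [← hX.span y hyV, Submodule.mem_span_range_iff_exists_fun] at hm
  obtain ⟨a, ha⟩ := hm
  refine ⟨V, fun x => ∑ k, a k • X k x, hyV, ⟨hX.isOpen, ?_, fun x hx => ?_⟩, ha⟩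
  · exact ContMDiffOn.sum_section fun k _ => ContMDiffOn.const_smul_section (hX.smooth k)
  · rw [← hX.span x hx]
    exact Submodule.sum_mem _ fun k _ => Submodule.smul_mem _ _ (Submodule.subset_span ⟨k, rfl⟩)

end Frames

/-! ### Stability, regular stability and the theorem. -/

section Stability

variable {n : ℕ} {M : Type*} [TopologicalSpace M] [ChartedSpace (EuclideanSpace ℝ (Fin n)) M]
  [IsManifold (𝓡 n) ∞ M] {nabla : Connection n M} {p q : ℕ} {D D' : SubspaceField n M}

/-- The coordinate expression of stability. -/
theorem IsStable.fderiv_add_mem (hst : IsStable nabla D D') (hD' : IsDistribution q D') {x₀ : M}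
    {Γ : EuclideanSpace ℝ (Fin n) →L[ℝ] EuclideanSpace ℝ (Fin n) →L[ℝ] EuclideanSpace ℝ (Fin n)}
    {z : EuclideanSpace ℝ (Fin n)} (hz : HasChristoffelAt nabla x₀ Γ z)
    {u : EuclideanSpace ℝ (Fin n) → EuclideanSpace ℝ (Fin n)}
    (hu : ∀ᶠ y in 𝓝 z, ContDiffAt ℝ ∞ u y ∧ u y ∈ chartDirections x₀ D y)
    {v : EuclideanSpace ℝ (Fin n)} (hv : v ∈ chartDirections x₀ D' z) :
    fderiv ℝ u z v + Γ v (u z) ∈ chartDirections x₀ D z := by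
  have hzt := hz.mem_target
  obtain ⟨W, hW, hWo, hzW⟩ := eventually_nhds_iff.1 hu
  obtain ⟨m, hm, rfl⟩ := hv
  -- Stability speaks of fields of `D'`, so the single vector is first extended to one.
  obtain ⟨V, Y, hyV, hY, rfl⟩ := hD'.exists_isFieldOf hm
  set φ := extChartAt (𝓡 n) x₀ with hφ
  have hX : IsFieldOf D (φ.source ∩ φ ⁻¹' W) (chartField x₀ u) := by
    refine ⟨isOpen_source_inter_preimage x₀ hWo,
      smoothFieldOn_chartField Set.inter_subset_left fun y hy => (hW _ hy.2).1, fun y hy => ?_⟩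
    have h1 := (hW _ hy.2).2
    have h2 := φ.map_source hy.1
    rw [← chartRep_chartField h2 u, chartRep_mem_chartDirections h2, φ.left_inv hy.1] at h1
    exact h1
  have hzU : φ.symm z ∈ φ.source ∩ φ ⁻¹' W :=
    ⟨φ.map_target hzt, by simpa [φ.right_inv hzt] using hzW⟩
  have h3 := hst ((φ.source ∩ φ ⁻¹' W) ∩ V) (chartField x₀ u) Y
    ⟨hX.isOpen.inter hY.isOpen, ContMDiffOn.mono hX.smooth Set.inter_subset_left,
      fun y hy => hX.mem y hy.1⟩
    ⟨hX.isOpen.inter hY.isOpen, ContMDiffOn.mono hY.smooth Set.inter_subset_right,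
      fun y hy => hY.mem y hy.2⟩ (φ.symm z) ⟨hzU, hyV⟩
  rw [← chartRep_mem_chartDirections hzt] at h3
  have hue := chartRep_chartField_eventuallyEq' hzt u
  rw [hz.chartRep_covDeriv Y (hu.self_of_nhds.1.congr_of_eventuallyEq hue), hue.fderiv_eq,
    hue.self_of_nhds] at h3
  exact h3

/-- A stable distribution is regularly stable in the presence of a gauge. -/
theorem IsStable.isRegularlyStable (hst : IsStable nabla D D') (hD : IsDistribution p D)
    (hD' : IsDistribution q D')
    (hgauge : ∀ x₀ : M, ∃ Γ : EuclideanSpace ℝ (Fin n) →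
        EuclideanSpace ℝ (Fin n) →L[ℝ] EuclideanSpace ℝ (Fin n) →L[ℝ] EuclideanSpace ℝ (Fin n),
      (∀ᶠ z in 𝓝 (extChartAt (𝓡 n) x₀ x₀), HasChristoffelAt nabla x₀ (Γ z) z) ∧
        HasGauge x₀ D' Γ) :
    IsRegularlyStable nabla p D D' := by
  intro x₀
  obtain ⟨U, hxU, X, hX⟩ := hD x₀
  obtain ⟨Γ, hΓ, B, hB₀, hB⟩ := hgauge x₀
  set φ := extChartAt (𝓡 n) x₀ with hφ
  have hU : ∀ᶠ z in 𝓝 (φ x₀), φ.symm z ∈ U :=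
    (tendsto_extChartAt_symm (n := n) x₀).eventually (hX.isOpen.mem_nhds hxU)
  obtain ⟨w, hw⟩ := exists_parallel_frame_of_stable (w := frameRep x₀ X)
    (L := fun z => chartDirections x₀ D' z) hB₀ hB
    (by
      filter_upwards [hU, hΓ] with z h1 h2
      exact ⟨hX.contDiffAt_frameRep h2.mem_target h1, hX.frameRep_injective h2.mem_target h1⟩)
    (by
      filter_upwards [hU.eventually_nhds, hΓ] with z h1 h2 u hu v hv
      rw [hX.range_frameRep h1.self_of_nhds]
      refine hst.fderiv_add_mem hD' h2 ?_ hv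
      filter_upwards [h1, hu] with y h3 h4
      rwa [hX.range_frameRep h3] at h4)
  obtain ⟨W, hW, hWo, hxW⟩ := eventually_nhds_iff.1 ((hw.and hU).and hΓ)
  refine ⟨φ.source ∩ φ ⁻¹' W, ⟨mem_extChartAt_source x₀, hxW⟩, _, isLocalBasis_chartField hWo fun z hz =>
    ⟨(hW z hz).1.1.1, (hW z hz).1.1.2.1,
      (hW z hz).1.1.2.2.1.trans (hX.range_frameRep (hW z hz).1.2)⟩, ?_⟩
  rintro k V Y hY y ⟨⟨hys, hyW⟩, hyV⟩
  obtain ⟨⟨⟨hws, -, -, hpar⟩, -⟩, hch⟩ := hW _ hyW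
  apply toChart_injective hys
  have hzt := hch.mem_target
  have hue := chartRep_chartField_eventuallyEq' hzt fun z => w z (Pi.single k 1)
  have hd : ContDiffAt ℝ ∞ (fun z => w z (Pi.single k 1)) (φ y) := hws.clm_apply contDiffAt_const
  rw [map_zero, ← chartRep_apply hys,
    hch.chartRep_covDeriv Y (hd.congr_of_eventuallyEq hue), hue.fderiv_eq, hue.self_of_nhds]
  have hv : chartRep x₀ Y (φ y) ∈ chartDirections x₀ D' (φ y) := by
    rw [chartRep_mem_chartDirections hzt, φ.left_inv hys]
    exact hY.mem y hyV
  have h1 := hpar _ hv (Pi.single k 1)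
  rw [fderiv_clm_apply (hws.differentiableAt (by simp)) (differentiableAt_const _)]
  simpa [-extChartAt, hφ] using h1

/-- A regularly stable distribution is stable. -/
theorem IsRegularlyStable.isStable (hreg : IsRegularlyStable nabla p D D')
    (hchr : ∀ x₀ : M, ∃ Γ, HasChristoffelAt nabla x₀ Γ (extChartAt (𝓡 n) x₀ x₀)) :
    IsStable nabla D D' := by
  intro U X Y hX hY x hx
  obtain ⟨U₁, hxU₁, F, hF, hpar⟩ := hreg x
  obtain ⟨Γ, hΓ⟩ := hchr x
  set φ := extChartAt (𝓡 n) x with hφ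
  have hxs : x ∈ φ.source := mem_extChartAt_source x
  have hsymm : φ.symm (φ x) = x := φ.left_inv hxs
  have hU : ∀ᶠ z in 𝓝 (φ x), φ.symm z ∈ U :=
    (tendsto_extChartAt_symm (n := n) x).eventually (hX.isOpen.mem_nhds hx)
  have hU₁ : ∀ᶠ z in 𝓝 (φ x), φ.symm z ∈ U₁ :=
    (tendsto_extChartAt_symm (n := n) x).eventually (hF.isOpen.mem_nhds hxU₁)
  have hzt := hΓ.mem_target
  have hXs := contDiffAt_chartRep hX.isOpen hX.smooth hzt hU.self_of_nhds
  have hFs := fun k => contDiffAt_chartRep hF.isOpen (hF.smooth k) hzt hU₁.self_of_nhds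
  have h1 := mem_range_of_parallel_frame (Γ := Γ (chartRep x Y (φ x))) (w := frameRep x F)
    (v := chartRep x Y (φ x))
    ((hF.contDiffAt_frameRep hzt hU₁.self_of_nhds).differentiableAt (by simp))
    (hF.frameRep_injective hzt hU₁.self_of_nhds)
    (hXs.differentiableAt (by simp)) (by
      filter_upwards [hU, hU₁, extChartAt_target_mem_nhds x] with z h2 h3 h4
      rw [hF.range_frameRep h3, chartRep_mem_chartDirections h4]
      exact hX.mem _ h2) (by
      intro a
      rw [fderiv_frameRep_apply hFs, frameRep_apply, map_sum, ← Finset.sum_add_distrib]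
      refine Finset.sum_eq_zero fun k _ => ?_
      rw [map_smul, ← smul_add, ← hΓ.chartRep_covDeriv Y (hFs k), chartRep_apply hxs,
        hpar k U Y hY x ⟨hxU₁, hx⟩, map_zero, smul_zero])
  rw [hF.range_frameRep hU₁.self_of_nhds, ← hΓ.chartRep_covDeriv Y hXs,
    chartRep_mem_chartDirections hzt, hsymm] at h1
  exact h1

end Stability

end Foliation

theorem corollary1 {n : ℕ} {M : Type*} [TopologicalSpace M] [T2Space M]
    [ChartedSpace (EuclideanSpace ℝ (Fin n)) M] [IsManifold (𝓡 n) ∞ M]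
    (g : Foliation.PseudoRiemannianMetric n M) (nabla : Foliation.Connection n M)
    (hnabla : Foliation.IsLeviCivita g nabla)
    (p q : ℕ) (Ω Ω' : Foliation.SubspaceField n M)
    (hΩ : Foliation.IsDistribution p Ω) (hΩ' : Foliation.IsFoliation q Ω') :
    (Foliation.IsFlat nabla →
      (Foliation.IsStable nabla Ω Ω' ↔ Foliation.IsRegularlyStable nabla p Ω Ω')) ∧
    (q = 1 →
      (Foliation.IsStable nabla Ω Ω' ↔ Foliation.IsRegularlyStable nabla p Ω Ω')) := by
  have hchr := Foliation.exists_hasChristoffelAt nabla hnabla.smooth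
  -- The Leibniz direction, common to both parts.
  have hrev : Foliation.IsRegularlyStable nabla p Ω Ω' → Foliation.IsStable nabla Ω Ω' :=
    fun hreg => hreg.isStable fun x₀ =>
      let ⟨Γ, _, hΓ⟩ := hchr x₀
      ⟨_, hΓ.self_of_nhds⟩
  refine ⟨fun hflat => ⟨fun hst => hst.isRegularlyStable hΩ hΩ'.1 fun x₀ => ?_, hrev⟩,
    fun hq => ⟨fun hst => hst.isRegularlyStable hΩ hΩ'.1 fun x₀ => ?_, hrev⟩⟩
  · obtain ⟨Γ, hΓs, hΓ⟩ := hchr x₀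
    exact ⟨Γ, hΓ, hflat.hasGauge hΓs hΓ⟩
  · obtain ⟨Γ, hΓs, hΓ⟩ := hchr x₀
    subst hq
    exact ⟨Γ, hΓ, hΩ'.1.hasGauge hΓs⟩
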